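/- **Setting.** Inputs are $x=(x^1,\dots,x^n)\in(\mathbb S^{d-1})^n$. For $\sigma:\mathbb R\to\mathbb R$ square integrable for the standard Gaussian (an *activation*) let $\|\sigma\|=\sqrt{\mathbb E_{X\sim N(0,1)}\sigma(X)^2}$ and $\hat\sigma(\rho)=\mathbb E[\sigma(X)\sigma(Y)]$ with $(X,Y)$ centred Gaussian with covariance $\begin{pmatrix}1&\rho\\ \rho&1\end{pmatrix}$. A *skeleton* $\mathcal S$ is a finite directed acyclic graph whose input nodes (those with no incoming edge) each correspond to a coordinate $x^i$, whose non-input nodes $v$ are labelled by activations $\sigma_v$, and which has a single output node $o$ (node without outgoing edges among the non-input nodes). $|\mathcal S|$ is the number of non-input nodes, $\mathrm{depth}(\mathcal S)$ the length of a longest directed path, and $\mathrm{IN}(v)$ the set of in-neighbours of $v$. The *compositional kernel* is $\kappa_{\mathcal S}=\kappa_o$, where $\kappa_v(x,x')=\langle x^i,x'^i\rangle$ for an input node $v$ corresponding to the $i$th coordinate and $\kappa_v=\hat\tau_v\big(|\mathrm{IN}(v)|^{-1}\sum_{u\in \mathrm{IN}(v)}\kappa_u\big)$ with $\tau_v=\sigma_v/\|\sigma_v\|$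 otherwise. The *$r$-fold realization* $\mathcal N(\mathcal S,r)$ is the neural network with $d$ input neurons, of vertex weight $1/d$, for each input node of $\mathcal S$ (carrying the $d$ entries of the corresponding coordinate), $r$ neurons with activation $\sigma_v$, of vertex weight $1/r$, for each non-input node $v$, and an edge between two neurons whenever there is one between the corresponding nodes; a neuron $v$ outputs $\sigma_v$ of the weighted sum of the outputs of its in-neighbours. In a *random initialization* the edge weights $w_{uv}$ are independent centred Gaussians with variance $d\,\omega(u)/\omega(\mathrm{IN}(v))$ if $u$ is an input neuron and $\omega(u)/(\|\sigma_u\|^2\,\omega(\mathrm{IN}(v)))$ otherwise, where $\omega$ denotes the (total) vertex weight. The *empirical kernel* is $\kappa_w(x,x')=\langle\Psi_w(x),\Psi_w(x')\rangle$, where $\Psi_w$ is the vector of the outputs of the $q$ $(=r)$ output neurons $v$, each divided by $\|\sigma_v\|\sqrt q$. **Theorem 2.** There are universal constants $c_1,c_2>0$ such that the following holds. Let $\mathcal S$ be a skeleton all of whose activations are ReLU ($\sigma(t)=\max(t,0)$, or a positive multiple of it such as the normalized $\sqrt2\max(t,0)$), let $0<\delta<1$, $0<\epsilon\le\min\big(c_2,\tfrac1{\mathrm{depth}(\mathcal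 S)}\big)$, and let $r\ge1$ be an integer with $$r\ \ge\ c_1\,\frac{\mathrm{depth}(\mathcal S)^2\,\log\!\big(8|\mathcal S|/\delta\big)}{\epsilon^2}.$$ Then for all fixed inputs $x,x'$, with probability at least $1-\delta$ over a random initialization $w$ of $\mathcal N(\mathcal S,r)$, $$|\kappa_w(x,x')-\kappa_{\mathcal S}(x,x')|\le\epsilon .$$ -/

import Mathlib

open MeasureTheory ProbabilityTheory
open scoped NNReal RealInnerProductSpace

/-! ### Activations and their duals -/

/-- The norm `‖σ‖ = √(E_{X ∼ N(0,1)} σ(X)²)` of an activation. -/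
noncomputable def actNorm (σ : ℝ → ℝ) : ℝ :=
  √(∫ x, σ x ^ 2 ∂(gaussianReal 0 1))

/-- The activation `σ / ‖σ‖`. -/
noncomputable def normalizedAct (σ : ℝ → ℝ) : ℝ → ℝ := fun x => σ x / actNorm σ

/-- The centred Gaussian distribution on `ℝ²` with covariance matrix `(1, ρ; ρ, 1)`. -/
noncomputable def gaussianPair (ρ : ℝ) : Measure (EuclideanSpace ℝ (Fin 2)) :=
  multivariateGaussian 0 !![1, ρ; ρ, 1]

/-- The dual activation `σ̂(ρ) = E_{(X,Y) ∼ N_ρ} σ(X) σ(Y)`. -/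
noncomputable def dualAct (σ : ℝ → ℝ) (ρ : ℝ) : ℝ :=
  ∫ z, σ (z 0) * σ (z 1) ∂(gaussianPair ρ)

/-- The ReLU activation, up to a positive scaling. This covers both `x ↦ max x 0` and the
normalized `x ↦ √2 * max x 0`. -/
def IsReLU (σ : ℝ → ℝ) : Prop := ∃ a : ℝ, 0 < a ∧ ∀ x, σ x = a * max x 0

/-! ### Directed acyclic graphs labelled by activations -/

/-- A directed acyclic graph with vertex set `I ⊕ U`, whose input nodes (those without incoming
edges) are the elements of `I`, and whose non-input nodes, the elements of `U`, are labelled by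
activations, that is, by functions that are square integrable for the standard Gaussian measure. -/
structure ActivationDAG (I U : Type*) where
  /-- `edge u v` : there is an edge from `u` to the non-input node `v`. -/
  edge : I ⊕ U → U → Prop
  acyclic : ∀ v, ¬ Relation.TransGen (fun u v => edge (.inr u) v) v v
  exists_edge : ∀ v, ∃ u, edge u v
  act : U → ℝ → ℝ
  act_memLp : ∀ v, MemLp (act v) 2 (gaussianReal 0 1)

namespace ActivationDAG

variable {I U : Type*}

/-- The set `IN(v)` of the neighbours incoming to `v`. -/
abbrev In (G : ActivationDAG I U) (v : U) : Type _ := {u : I ⊕ U // G.edge u v}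

theorem wellFounded [Finite U] (G : ActivationDAG I U) :
    WellFounded (fun u v => G.edge (.inr u) v) := by
  have : Std.Irrefl (Relation.TransGen (fun u v => G.edge (.inr u) v)) := ⟨G.acyclic⟩
  exact Subrelation.wf (fun h => Relation.TransGen.single h)
    (Finite.wellFounded_of_trans_of_irrefl (Relation.TransGen (fun u v => G.edge (.inr u) v)))

/-- Propagation of values through the graph: the value at an input node `i` is `base i`, and the
value at a non-input node `v` is computed by `step v` from the values at the nodes in `IN(v)`
(see `propagate_inl` and `propagate_inr`). -/
noncomputable def propagate [Finite U] (G : ActivationDAG I U) {α : Type*} (base : I → α)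
    (step : (v : U) → (G.In v → α) → α) : I ⊕ U → α :=
  Sum.elim base (G.wellFounded.fix fun v rec => step v fun u =>
    match u with
    | ⟨.inl i, _⟩ => base i
    | ⟨.inr u, h⟩ => rec u h)

theorem propagate_inl [Finite U] (G : ActivationDAG I U) {α : Type*} (base : I → α)
    (step : (v : U) → (G.In v → α) → α) (i : I) :
    G.propagate base step (.inl i) = base i := rfl

theorem propagate_inr [Finite U] (G : ActivationDAG I U) {α : Type*} (base : I → α)
    (step : (v : U) → (G.In v → α) → α) (v : U) :
    G.propagate base step (.inr v) = step v fun u => G.propagate base step u.1 := by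
  conv_lhs => rw [propagate, Sum.elim_inr, WellFounded.fix_eq]
  congr 1
  funext u
  rcases u with ⟨u | u, h⟩ <;> rfl

open scoped Classical in
/-- The length of a longest directed path ending at a given node. -/
noncomputable def depthAt [Fintype I] [Fintype U] (G : ActivationDAG I U) : I ⊕ U → ℕ :=
  G.propagate (fun _ => 0) fun _ f => Finset.univ.sup fun u => f u + 1

/-- A non-input node without outgoing edges. -/
def IsOutput (G : ActivationDAG I U) (v : U) : Prop := ∀ w, ¬ G.edge (.inr v) w

end ActivationDAG

/-- The input space `(𝕊^{d-1})^n`. -/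
abbrev InputSpace (n d : ℕ) : Type := Fin n → Metric.sphere (0 : EuclideanSpace ℝ (Fin d)) 1

/-! ### Neural networks -/

/-- A neural network: a vertex-weighted directed acyclic graph labelled by activations, each of
whose input neurons `i` reads off one scalar entry `(x^c)_j`, `(c, j) = entry i`, of the input. -/
structure NeuralNetwork (n d : ℕ) (I U : Type*) extends ActivationDAG I U where
  entry : I → Fin n × Fin d
  /-- The vertex weights, used only for the distribution of the random initial weights. -/
  weight : I ⊕ U → ℝ≥0

namespace NeuralNetwork

variable {n d : ℕ} {I U : Type*} [Fintype I] [Fintype U]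

/-- The edges of the network. -/
abbrev Edge (N : NeuralNetwork n d I U) : Type _ := {e : (I ⊕ U) × U // N.edge e.1 e.2}

open scoped Classical in
/-- The output `h_{v,w}(x)` of the neuron `v` for the edge weights `w`. -/
noncomputable def output (N : NeuralNetwork n d I U) (w : N.Edge → ℝ) (x : InputSpace n d) :
    I ⊕ U → ℝ :=
  N.propagate (fun i => (x (N.entry i).1 : EuclideanSpace ℝ (Fin d)) (N.entry i).2)
    fun v h => N.act v (∑ u : N.In v, w ⟨(u.1, v), u.2⟩ * h u)

open scoped Classical in
/-- The total vertex weight of `IN(v)`. -/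
noncomputable def inWeight (N : NeuralNetwork n d I U) (v : U) : ℝ :=
  ∑ u : N.In v, (N.weight u.1 : ℝ)

/-- The variance of the initial weight of an edge. -/
noncomputable def initVariance (N : NeuralNetwork n d I U) (e : N.Edge) : ℝ :=
  match e.1.1 with
  | .inl i => d * N.weight (.inl i) / N.inWeight e.1.2
  | .inr u => N.weight (.inr u) / (actNorm (N.act u) ^ 2 * N.inWeight e.1.2)

open scoped Classical in
/-- The law of the random initialization: the weights are independent centred Gaussians with
the variances `initVariance`. -/
noncomputable def randomInit (N : NeuralNetwork n d I U) : Measure (N.Edge → ℝ) :=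
  Measure.pi fun e => gaussianReal 0 (N.initVariance e).toNNReal

/-- The output neurons of a (representation) network. -/
abbrev Outputs (N : NeuralNetwork n d I U) : Type _ := {v : U // N.IsOutput v}

open scoped Classical in
/-- The normalized representation `Ψ_w`: each output neuron `v` is divided by `‖σ_v‖ √q`, where
`q` is the number of output neurons. -/
noncomputable def normalizedRep (N : NeuralNetwork n d I U) (w : N.Edge → ℝ)
    (x : InputSpace n d) : EuclideanSpace ℝ N.Outputs :=
  WithLp.toLp 2 fun v =>
    N.output w x (.inr v.1) / (actNorm (N.act v.1) * √(Fintype.card N.Outputs))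

open scoped Classical in
/-- The empirical kernel `κ_w(x, x') = ⟪Ψ_w(x), Ψ_w(x')⟫`. -/
noncomputable def empiricalKernel (N : NeuralNetwork n d I U) (w : N.Edge → ℝ)
    (x x' : InputSpace n d) : ℝ :=
  ⟪N.normalizedRep w x, N.normalizedRep w x'⟫

end NeuralNetwork

/-! ### Computation skeletons -/

/-- A computation skeleton on inputs with `n` coordinates: a directed acyclic graph whose
non-input nodes are labelled by activations, with a single output node, which is not an input
node. Each input node corresponds to a coordinate of the input. -/
structure ComputationSkeleton (n : ℕ) (I U : Type*) extends ActivationDAG I U where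
  coord : I → Fin n
  out : U
  isOutput_iff : ∀ v, toActivationDAG.IsOutput v ↔ v = out

namespace ComputationSkeleton

variable {n : ℕ} {I U : Type*} [Fintype I] [Fintype U]

/-- `|S|`, the number of non-input nodes. -/
def size (_S : ComputationSkeleton n I U) : ℕ := Fintype.card U

/-- The depth of the skeleton: the length of a longest directed path. -/
noncomputable def depth (S : ComputationSkeleton n I U) : ℕ :=
  Finset.univ.sup S.depthAt

open scoped Classical in
/-- The kernel `κ_v` at the node `v` (activations that are not normalized are replaced by their
normalizations). -/
noncomputable def nodeKernel (S : ComputationSkeleton n I U) {d : ℕ} (x x' : InputSpace n d) :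
    I ⊕ U → ℝ :=
  S.propagate
    (fun i => ⟪(x (S.coord i) : EuclideanSpace ℝ (Fin d)),
      (x' (S.coord i) : EuclideanSpace ℝ (Fin d))⟫)
    fun v κ => dualAct (normalizedAct (S.act v)) ((∑ u : S.In v, κ u) / Fintype.card (S.In v))

/-- The compositional kernel `κ_S`. -/
noncomputable def kernel (S : ComputationSkeleton n I U) {d : ℕ} (x x' : InputSpace n d) : ℝ :=
  S.nodeKernel x x' (.inr S.out)

/-- The `r`-fold realization `N(S, r)`: each input node of `S` gives `d` input neurons of weight
`1/d`, one for each entry of the corresponding coordinate of the input, and each non-input node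
gives `r` neurons with the same activation, of weight `1/r`. There is an edge between two neurons
whenever there is one between the corresponding nodes. This is the network without an additional
linear output layer, that is, the representation part of the realization. -/
noncomputable def realization (S : ComputationSkeleton n I U) (d r : ℕ) [NeZero d] [NeZero r] :
    NeuralNetwork n d (I × Fin d) (U × Fin r) where
  edge a b := S.edge (Sum.map Prod.fst Prod.fst a) b.1
  acyclic v h := S.acyclic v.1 (Relation.TransGen.lift Prod.fst (fun _ _ hab => hab) _ _ h)
  exists_edge v := by
    obtain ⟨u | u, h⟩ := S.exists_edge v.1
    · exact ⟨.inl (u, 0), h⟩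
    · exact ⟨.inr (u, 0), h⟩
  act v := S.act v.1
  act_memLp v := S.act_memLp v.1
  entry a := (S.coord a.1, a.2)
  weight := Sum.elim (fun _ => 1 / (d : ℝ≥0)) (fun _ => 1 / (r : ℝ≥0))

end ComputationSkeleton

/-! For ReLU the error does not get amplified from one layer to the next. The dual activation is the
arc-cosine kernel, and its degree-one homogeneous extension, which sends a covariance matrix with
entries a, b, c and b = √a √c cos θ to √a √c · `arcCosKernel θ`, is nonexpansive in the supremum
norm near the matrices of unit diagonal (`abs_mul_arcCosKernel_sub_le`,
`abs_sqrt_mul_sqrt_sub_one_le`). Kernel errors of size η at the in-neighbours of a node therefore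
cost at most η in the conditional expectation at the node.

Sampling adds a fresh error. With all weights not entering the node `v` fixed, the preactivations of
its `r` neurons at two inputs are independent Gaussian pairs, whose covariance is the average of the
empirical kernels at the in-neighbours. Products of two rectified Gaussians are subexponential
(`integrable_exp_relu_and_integral_le`), so a Chernoff bound gives deviation `t` with probability at
most 2 exp(-r t² / 32768) (`measureReal_mean_relu_sub_ge_le`). The conditioning is carried out by
resampling the weights into `v` and Fubini (`measureReal_pi_le_of_forall_piecewise`).

Errors thus accumulate additively, at most `depthAt u * t` at a node `u`. A union bound over the
nodes and the four ordered pairs of inputs, with `t = ε / depth`, gives the result. -/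

/-! ### The arc-cosine kernel: nonexpansiveness and Gaussian integral -/

open Real in
theorem sin_sub_sin_le_sub_mul_cos {θ φ : ℝ} (hθ : θ ∈ Set.Icc 0 π) (hφ : φ ∈ Set.Icc 0 π) :
    sin φ - sin θ ≤ (φ - θ) * cos θ := by
  have hc := strictConcaveOn_sin_Icc.concaveOn
  rcases lt_trichotomy θ φ with h | rfl | h
  · have := hc.slope_le_of_hasDerivAt hθ hφ h (hasDerivAt_sin θ)
    rw [slope_def_field, div_le_iff₀ (sub_pos.2 h)] at this
    linarith
  · simp
  · have := hc.le_slope_of_hasDerivAt hφ hθ h (hasDerivAt_sin θ)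
    rw [slope_def_field, le_div_iff₀ (sub_pos.2 h)] at this
    linarith

/-- The normalized arc-cosine kernel of order one, as a function of the angle. -/
noncomputable def arcCosKernel (θ : ℝ) : ℝ :=
  (Real.sin θ + (Real.pi - θ) * Real.cos θ) / Real.pi

-- In the coordinates (s, s cos θ), the function s · `arcCosKernel θ` is convex with gradient (sin
-- θ, π - θ) / π. The gradient inequality comes from concavity of sine, and sin θ ≤ θ bounds the ℓ¹
-- norm of the gradient by 1.
open Real in
theorem mul_arcCosKernel_sub_le {s s' θ θ' η : ℝ} (hs' : 0 ≤ s')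
    (hθ : θ ∈ Set.Icc 0 π) (hθ' : θ' ∈ Set.Icc 0 π) (h₁ : |s - s'| ≤ η)
    (h₂ : |s * cos θ - s' * cos θ'| ≤ η) :
    s * arcCosKernel θ - s' * arcCosKernel θ' ≤ η := by
  have hsin : sin θ ≤ θ := sin_le hθ.1
  have hsin0 : 0 ≤ sin θ := sin_nonneg_of_mem_Icc hθ
  have hη : 0 ≤ η := (abs_nonneg _).trans h₁
  have key := mul_le_mul_of_nonneg_left (sin_sub_sin_le_sub_mul_cos hθ' hθ) hs'
  have e₁ := mul_le_mul_of_nonneg_right (le_of_abs_le h₁) hsin0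
  have e₂ := mul_le_mul_of_nonneg_right (le_of_abs_le h₂) (sub_nonneg.2 hθ.2)
  have e₃ := mul_le_mul_of_nonneg_left hsin hη
  rw [arcCosKernel, arcCosKernel, ← mul_div_assoc, ← mul_div_assoc, ← sub_div,
    div_le_iff₀ pi_pos]
  nlinarith

/-- The degree one homogeneous extension of the arc-cosine kernel is nonexpansive for the
supremum norm. -/
theorem abs_mul_arcCosKernel_sub_le {s s' θ θ' η : ℝ} (hs : 0 ≤ s) (hs' : 0 ≤ s')
    (hθ : θ ∈ Set.Icc 0 Real.pi) (hθ' : θ' ∈ Set.Icc 0 Real.pi) (h₁ : |s - s'| ≤ η)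
    (h₂ : |s * Real.cos θ - s' * Real.cos θ'| ≤ η) :
    |s * arcCosKernel θ - s' * arcCosKernel θ'| ≤ η := by
  rw [abs_sub_le_iff]
  refine ⟨mul_arcCosKernel_sub_le hs' hθ hθ' h₁ h₂, mul_arcCosKernel_sub_le hs hθ' hθ ?_ ?_⟩
  · rwa [abs_sub_comm]
  · rwa [abs_sub_comm]

open Real in
theorem arcCosKernel_le_one {θ : ℝ} (hθ : θ ∈ Set.Icc 0 π) : arcCosKernel θ ≤ 1 := by
  rw [arcCosKernel, div_le_one pi_pos]
  nlinarith [sin_le hθ.1, mul_le_mul_of_nonneg_left (cos_le_one θ) (sub_nonneg.2 hθ.2)]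

theorem arcCosKernel_zero : arcCosKernel 0 = 1 := by
  simp [arcCosKernel, Real.pi_ne_zero]

-- Both cosines are nonnegative exactly on the arc from θ - π/2 to π/2, up to endpoints and boundary
-- cases; there twice their product is cos θ + cos (2φ - θ).
open Real in
theorem integral_max_cos_mul_max_cos_sub {θ : ℝ} (hθ : θ ∈ Set.Icc 0 π) :
    ∫ φ in (-π)..π, 2 * (max (cos φ) 0 * max (cos (φ - θ)) 0) =
      sin θ + (π - θ) * cos θ := by
  have hc : Continuous fun φ => 2 * (max (cos φ) 0 * max (cos (φ - θ)) 0) := by fun_prop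
  obtain ⟨h0, hπ⟩ := hθ
  rw [← intervalIntegral.integral_add_adjacent_intervals (b := θ - π / 2)
      (hc.intervalIntegrable _ _) (hc.intervalIntegrable _ _),
    ← intervalIntegral.integral_add_adjacent_intervals (a := θ - π / 2) (b := π / 2)
      (hc.intervalIntegrable _ _) (hc.intervalIntegrable _ _)]
  have e₁ : ∫ φ in (-π)..(θ - π / 2), 2 * (max (cos φ) 0 * max (cos (φ - θ)) 0) = 0 := by
    refine intervalIntegral.integral_zero_ae (Filter.Eventually.of_forall fun φ hφ => ?_)
    rw [Set.uIoc_of_le (by linarith)] at hφ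
    rcases le_total φ (-(π / 2)) with h | h
    · have : cos φ ≤ 0 := by
        rw [← cos_neg]
        exact cos_nonpos_of_pi_div_two_le_of_le (by linarith) (by linarith [hφ.1])
      simp [max_eq_right this]
    · have : cos (φ - θ) ≤ 0 := by
        rw [← cos_neg]
        exact cos_nonpos_of_pi_div_two_le_of_le (by linarith [hφ.2]) (by linarith)
      simp [max_eq_right this]
  have e₃ : ∫ φ in (π / 2)..π, 2 * (max (cos φ) 0 * max (cos (φ - θ)) 0) = 0 := by
    refine intervalIntegral.integral_zero_ae (Filter.Eventually.of_forall fun φ hφ => ?_)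
    rw [Set.uIoc_of_le (by linarith [pi_pos])] at hφ
    have : cos φ ≤ 0 :=
      cos_nonpos_of_pi_div_two_le_of_le hφ.1.le (by linarith [hφ.2, pi_pos])
    simp [max_eq_right this]
  have e₂ : ∫ φ in (θ - π / 2)..(π / 2), 2 * (max (cos φ) 0 * max (cos (φ - θ)) 0) =
      ∫ φ in (θ - π / 2)..(π / 2), (cos θ + cos (2 * φ - θ)) := by
    refine intervalIntegral.integral_congr fun φ hφ => ?_
    rw [Set.uIcc_of_le (by linarith)] at hφ
    have h₁ : 0 ≤ cos φ := cos_nonneg_of_mem_Icc ⟨by linarith [hφ.1], hφ.2⟩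
    have h₂ : 0 ≤ cos (φ - θ) :=
      cos_nonneg_of_mem_Icc ⟨by linarith [hφ.1], by linarith [hφ.2]⟩
    simp only [max_eq_left h₁, max_eq_left h₂]
    rw [show 2 * φ - θ = φ + (φ - θ) by ring, cos_add]
    nth_rewrite 2 [show θ = φ - (φ - θ) by ring]
    rw [cos_sub φ (φ - θ)]
    ring
  rw [e₁, e₂, e₃, intervalIntegral.integral_eq_sub_of_hasDerivAt
    (f := fun φ => φ * cos θ + sin (2 * φ - θ) / 2)]
  · have a₁ : sin (2 * (π / 2) - θ) = sin θ := by
      rw [show 2 * (π / 2) - θ = π - θ by ring, sin_pi_sub]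
    have a₂ : sin (2 * (θ - π / 2) - θ) = - sin θ := by
      rw [show 2 * (θ - π / 2) - θ = θ - π by ring, sin_sub_pi]
    simp only [a₁, a₂]
    ring
  · intro φ _
    have := (((hasDerivAt_id φ).const_mul 2).sub_const θ).sin
    convert! ((hasDerivAt_id φ).mul_const (cos θ)).add (this.div_const 2) using 1
    simp
  · exact Continuous.intervalIntegrable (by fun_prop) _ _

/-- The radial factor in polar coordinates: one power of `r` is the Jacobian, two come from the
homogeneity of the two ReLUs. -/
theorem integral_Ioi_cube_mul_exp :
    ∫ r in Set.Ioi (0 : ℝ), r ^ 3 * Real.exp (-r ^ 2 / 2) = 2 := by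
  have := integral_rpow_mul_exp_neg_mul_rpow (p := 2) (q := 3) (b := 1 / 2) (by norm_num)
    (by norm_num) (by norm_num)
  rw [show ((3 : ℝ) + 1) / 2 = (1 : ℕ) + 1 by norm_num, Real.Gamma_nat_eq_factorial] at this
  have h2 : ((1 : ℝ) / 2) ^ (-((1 : ℕ) + 1 : ℝ)) * (1 / 2) * (Nat.factorial 1 : ℝ) = 2 := by
    rw [show (-((1 : ℕ) + 1 : ℝ)) = ((-2 : ℤ) : ℝ) by norm_num, Real.rpow_intCast]
    norm_num
  rw [show (-(3 + 1 : ℝ) / 2) = (-((1 : ℕ) + 1 : ℝ)) by norm_num, h2] at this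
  refine Eq.trans ?_ this
  refine setIntegral_congr_fun measurableSet_Ioi fun r _ => ?_
  have h₁ : r ^ (3 : ℝ) = r ^ 3 := by exact_mod_cast Real.rpow_natCast r 3
  simp only [h₁, Real.rpow_two]
  ring_nf

open Real in
theorem integral_gaussian_prod (f : ℝ × ℝ → ℝ) :
    ∫ z, f z ∂((gaussianReal 0 1).prod (gaussianReal 0 1)) =
      (2 * π)⁻¹ * ∫ z, exp (-(z.1 ^ 2 + z.2 ^ 2) / 2) * f z := by
  rw [gaussianReal_of_var_ne_zero 0 one_ne_zero, prod_withDensity (by fun_prop) (by fun_prop),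
    integral_withDensity_eq_integral_toReal_smul (by fun_prop)
      (Filter.Eventually.of_forall fun z => ENNReal.mul_lt_top gaussianPDF_lt_top
        gaussianPDF_lt_top), ← integral_const_mul]
  refine integral_congr_ae (Filter.Eventually.of_forall fun z => ?_)
  simp only [ENNReal.toReal_mul, toReal_gaussianPDF, gaussianPDFReal, smul_eq_mul, sub_zero,
    NNReal.coe_one, mul_one]
  have h : (√(2 * π))⁻¹ * (√(2 * π))⁻¹ = (2 * π)⁻¹ := by
    rw [← mul_inv, mul_self_sqrt (by positivity)]
  have h' : exp (-z.1 ^ 2 / 2) * exp (-z.2 ^ 2 / 2) = exp (-(z.1 ^ 2 + z.2 ^ 2) / 2) := by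
    rw [← exp_add]; congr 1; ring
  rw [← h, ← h']
  ring

-- Polar coordinates separate the integral: the radial factor 2 against the density constant 1/(2π)
-- leaves the angular integral divided by π.
open Real in
theorem integral_relu_mul_relu_gaussian_prod {θ : ℝ} (hθ : θ ∈ Set.Icc 0 π) :
    ∫ z, 2 * (max z.1 0 * max (cos θ * z.1 + sin θ * z.2) 0)
      ∂((gaussianReal 0 1).prod (gaussianReal 0 1)) = arcCosKernel θ := by
  rw [integral_gaussian_prod, ← integral_comp_polarCoord_symm]
  have e : ∀ p ∈ polarCoord.target, p.1 • (exp (-((polarCoord.symm p).1 ^ 2 +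
        (polarCoord.symm p).2 ^ 2) / 2) * (2 * (max (polarCoord.symm p).1 0 *
        max (cos θ * (polarCoord.symm p).1 + sin θ * (polarCoord.symm p).2) 0))) =
      (p.1 ^ 3 * exp (-p.1 ^ 2 / 2)) * (2 * (max (cos p.2) 0 * max (cos (p.2 - θ)) 0)) := by
    rintro ⟨r, φ⟩ h
    have hr : 0 ≤ r := le_of_lt (by simpa using h.1)
    simp only [polarCoord_symm_apply, smul_eq_mul]
    have h₁ : max (r * cos φ) 0 = r * max (cos φ) 0 := by
      rw [mul_max_of_nonneg _ _ hr, mul_zero]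
    have h₂ : max (cos θ * (r * cos φ) + sin θ * (r * sin φ)) 0 = r * max (cos (φ - θ)) 0 := by
      rw [mul_max_of_nonneg _ _ hr, mul_zero, cos_sub]
      congr 1
      ring
    have h₃ : (r * cos φ) ^ 2 + (r * sin φ) ^ 2 = r ^ 2 := by
      rw [mul_pow, mul_pow, ← mul_add, cos_sq_add_sin_sq, mul_one]
    rw [h₁, h₂, h₃]
    ring
  rw [setIntegral_congr_fun polarCoord.open_target.measurableSet e, polarCoord_target,
    Measure.volume_eq_prod, setIntegral_prod_mul (fun r => r ^ 3 * exp (-r ^ 2 / 2))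
      (fun φ => 2 * (max (cos φ) 0 * max (cos (φ - θ)) 0)), integral_Ioi_cube_mul_exp,
    ← integral_Ioc_eq_integral_Ioo, ← intervalIntegral.integral_of_le (by linarith [pi_pos]),
    integral_max_cos_mul_max_cos_sub hθ, arcCosKernel]
  field_simp

/-! ### Centred Gaussian pairs -/

/-- The law of `(p X, q (cos θ X + sin θ Y))` for independent standard Gaussians `X`, `Y`. -/
noncomputable def corrGaussian (p q θ : ℝ) : Measure (ℝ × ℝ) :=
  ((gaussianReal 0 1).prod (gaussianReal 0 1)).map
    fun z => (p * z.1, q * (Real.cos θ * z.1 + Real.sin θ * z.2))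

instance (p q θ : ℝ) : IsProbabilityMeasure (corrGaussian p q θ) :=
  Measure.isProbabilityMeasure_map (by fun_prop)

open Real in
theorem integral_exp_sq_div_four_gaussianReal :
    ∫ x, exp (x ^ 2 / 4) ∂(gaussianReal 0 1) = √2 := by
  rw [integral_gaussianReal_eq_integral_smul one_ne_zero]
  have : ∀ x : ℝ, gaussianPDFReal 0 1 x • exp (x ^ 2 / 4) =
      (√(2 * π))⁻¹ * exp (-(1 / 4) * x ^ 2) := fun x => by
    simp only [gaussianPDFReal, smul_eq_mul, sub_zero, NNReal.coe_one, mul_one]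
    rw [mul_assoc, ← exp_add]
    congr 2
    ring
  simp_rw [this]
  rw [integral_const_mul, integral_gaussian, ← sqrt_inv, ← sqrt_mul (by positivity)]
  congr 1
  field_simp
  norm_num

theorem integrable_exp_sq_div_four_gaussianReal :
    Integrable (fun x => Real.exp (x ^ 2 / 4)) (gaussianReal 0 1) := by
  -- The integral of a nonintegrable function is 0 by convention, so a nonzero value proves
  -- integrability.
  refine Integrable.of_integral_ne_zero ?_
  rw [integral_exp_sq_div_four_gaussianReal]
  positivity

section Pair

variable {Ω : Type*} [MeasurableSpace Ω] {P : Measure Ω} {X Y : Ω → ℝ}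

/-- Only the three second moments enter, so two centred Gaussian pairs sharing them have the same
law, degenerate cases included. -/
theorem charFunDual_map_prodMk (h : HasGaussianLaw (fun ω => (X ω, Y ω)) P)
    (hX : P[X] = 0) (hY : P[Y] = 0) (L : StrongDual ℝ (ℝ × ℝ)) :
    charFunDual (P.map fun ω => (X ω, Y ω)) L =
      Complex.exp (-((L (1, 0)) ^ 2 * Var[X; P] + 2 * (L (1, 0) * L (0, 1) * cov[X, Y; P]) +
        (L (0, 1)) ^ 2 * Var[Y; P] : ℝ) / 2) := by
  have := h.isProbabilityMeasure
  have hL : (L ∘ fun ω => (X ω, Y ω)) = fun ω => L (1, 0) * X ω + L (0, 1) * Y ω := by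
    ext ω
    have : (X ω, Y ω) = X ω • ((1 : ℝ), (0 : ℝ)) + Y ω • ((0 : ℝ), (1 : ℝ)) := by simp
    simp only [Function.comp_apply]
    rw [this, map_add, map_smul, map_smul, smul_eq_mul, smul_eq_mul]
    ring
  rw [h.charFunDual_map_eq, hL, integral_add (h.fst.integrable.const_mul _)
    (h.snd.integrable.const_mul _), integral_const_mul, integral_const_mul, hX, hY,
    variance_fun_add (h.fst.memLp_two.const_mul _) (h.snd.memLp_two.const_mul _),
    variance_const_mul, variance_const_mul, covariance_const_mul_left,
    covariance_const_mul_right]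
  congr 1
  push_cast
  ring

theorem covariance_sq_le (h : HasGaussianLaw (fun ω => (X ω, Y ω)) P) :
    cov[X, Y; P] ^ 2 ≤ Var[X; P] * Var[Y; P] := by
  have := h.isProbabilityMeasure
  -- Cauchy–Schwarz by the discriminant of Var[X + tY] as a quadratic in t.
  have key : ∀ t : ℝ, 0 ≤ Var[Y; P] * (t * t) + (2 * cov[X, Y; P]) * t + Var[X; P] := fun t => by
    have := variance_nonneg (fun ω => X ω + t * Y ω) P
    rw [variance_fun_add h.fst.memLp_two (h.snd.memLp_two.const_mul _), variance_const_mul,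
      covariance_const_mul_right] at this
    linarith
  have := discrim_le_zero key
  rw [discrim] at this
  linarith

theorem map_prodMk_eq_corrGaussian (h : HasGaussianLaw (fun ω => (X ω, Y ω)) P)
    (hX : P[X] = 0) (hY : P[Y] = 0) {p q θ : ℝ} (hp : Var[X; P] = p ^ 2)
    (hq : Var[Y; P] = q ^ 2) (hc : cov[X, Y; P] = p * q * Real.cos θ) :
    P.map (fun ω => (X ω, Y ω)) = corrGaussian p q θ := by
  have := h.isProbabilityMeasure
  let γ := gaussianReal 0 1
  have hγ : HasGaussianLaw (fun z : ℝ × ℝ => (z.1, z.2)) (γ.prod γ) :=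
    IsGaussian.hasGaussianLaw_id
  have hm : HasGaussianLaw (fun z : ℝ × ℝ =>
      (p * z.1, q * (Real.cos θ * z.1 + Real.sin θ * z.2))) (γ.prod γ) :=
    hγ.map_fun ((p • ContinuousLinearMap.fst ℝ ℝ ℝ).prod
      (q • (Real.cos θ • ContinuousLinearMap.fst ℝ ℝ ℝ +
        Real.sin θ • ContinuousLinearMap.snd ℝ ℝ ℝ)))
  have m1 : ∫ z, z.1 ∂(γ.prod γ) = 0 := by
    simp [integral_fun_fst (μ := γ) (ν := γ) (f := fun x => x), γ]
  have m2 : ∫ z, z.2 ∂(γ.prod γ) = 0 := by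
    simp [integral_fun_snd (μ := γ) (ν := γ) (f := fun x => x), γ]
  have v1 : Var[fun z : ℝ × ℝ => z.1; γ.prod γ] = 1 := by
    have := (measurePreserving_fst (μ := γ) (ν := γ)).variance_fun_comp (f := fun x => x)
      (by fun_prop)
    rw [this]
    simp [γ]
  have v2 : Var[fun z : ℝ × ℝ => z.2; γ.prod γ] = 1 := by
    have := (measurePreserving_snd (μ := γ) (ν := γ)).variance_fun_comp (f := fun x => x)
      (by fun_prop)
    rw [this]
    simp [γ]
  have c12 : cov[fun z : ℝ × ℝ => z.1, fun z : ℝ × ℝ => z.2; γ.prod γ] = 0 :=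
    (indepFun_prod (X := fun x : ℝ => x) (Y := fun x : ℝ => x) (μ := γ) (ν := γ)
      measurable_id measurable_id).covariance_eq_zero hγ.fst.memLp_two hγ.snd.memLp_two
  have l1 := hγ.fst.memLp_two
  have l2 := hγ.snd.memLp_two
  apply Measure.ext_of_charFunDual
  ext L
  rw [charFunDual_map_prodMk h hX hY, corrGaussian, charFunDual_map_prodMk hm]
  · have e1 : Var[fun z : ℝ × ℝ => p * z.1; γ.prod γ] = p ^ 2 := by
      rw [variance_const_mul, v1, mul_one]
    have e2 : Var[fun z : ℝ × ℝ => q * (Real.cos θ * z.1 + Real.sin θ * z.2); γ.prod γ] =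
        q ^ 2 := by
      rw [variance_const_mul, variance_fun_add (l1.const_mul _) (l2.const_mul _),
        variance_const_mul, variance_const_mul, covariance_const_mul_left,
        covariance_const_mul_right, v1, v2, c12]
      linear_combination q ^ 2 * Real.cos_sq_add_sin_sq θ
    have e3 : cov[fun z : ℝ × ℝ => p * z.1,
        fun z : ℝ × ℝ => q * (Real.cos θ * z.1 + Real.sin θ * z.2); γ.prod γ] =
        p * q * Real.cos θ := by
      rw [covariance_const_mul_left, covariance_const_mul_right,
        show (fun z : ℝ × ℝ => Real.cos θ * z.1 + Real.sin θ * z.2) =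
          (fun z => Real.cos θ * z.1) + fun z => Real.sin θ * z.2 from rfl,
        covariance_add_right l1 (l1.const_mul _) (l2.const_mul _),
        covariance_const_mul_right, covariance_const_mul_right, c12,
        covariance_self (by fun_prop), v1]
      ring
    rw [e1, e2, e3, hp, hq, hc]
  · rw [integral_const_mul, m1, mul_zero]
  · rw [integral_const_mul, integral_add (hγ.fst.integrable.const_mul _)
      (hγ.snd.integrable.const_mul _), integral_const_mul, integral_const_mul, m1, m2]
    simp

theorem exists_angle {a b c : ℝ} (ha : 0 ≤ a) (h : b ^ 2 ≤ a * c) :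
    ∃ θ ∈ Set.Icc 0 Real.pi, b = √a * √c * Real.cos θ := by
  have hb : |b| ≤ √a * √c := by
    rw [← Real.sqrt_mul ha]
    exact Real.abs_le_sqrt h
  refine ⟨Real.arccos (b / (√a * √c)), ⟨Real.arccos_nonneg _, Real.arccos_le_pi _⟩, ?_⟩
  rcases (mul_nonneg (Real.sqrt_nonneg a) (Real.sqrt_nonneg c)).eq_or_lt with h0 | h0
  -- In the degenerate case b = 0, and division by zero selects arccos 0, which is a valid angle.
  · rw [← h0] at hb ⊢
    simpa using hb
  · obtain ⟨h1, h2⟩ := abs_le.1 hb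
    rw [Real.cos_arccos (by rw [le_div_iff₀ h0]; linarith) (by rw [div_le_one h0]; exact h2)]
    rw [mul_div_cancel₀ _ h0.ne']

end Pair

theorem integral_relu_mul_relu_corrGaussian {p q θ : ℝ} (hp : 0 ≤ p) (hq : 0 ≤ q)
    (hθ : θ ∈ Set.Icc 0 Real.pi) :
    ∫ z, 2 * (max z.1 0 * max z.2 0) ∂(corrGaussian p q θ) = p * q * arcCosKernel θ := by
  rw [corrGaussian, integral_map (by fun_prop) (by fun_prop),
    ← integral_relu_mul_relu_gaussian_prod hθ, ← integral_const_mul]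
  congr 1 with z
  have h₁ : ∀ {p : ℝ} (x : ℝ), 0 ≤ p → max (p * x) 0 = p * max x 0 := fun x hp => by
    rw [mul_max_of_nonneg _ _ hp, mul_zero]
  simp only [h₁ _ hp, h₁ _ hq]
  ring

/-! ### Exponential moments of products of rectified Gaussians -/

/-- Variances at most 2 and |cos θ x + sin θ y|² ≤ x² + y² turn the factor 1/16 into at most 1/4 for
each standard variable, and each of these contributes √2. -/
theorem integrable_exp_corrGaussian_and_integral_le {p q : ℝ} (θ : ℝ) (hp : p ^ 2 ≤ 2)
    (hq : q ^ 2 ≤ 2) :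
    Integrable (fun z => Real.exp ((z.1 ^ 2 + z.2 ^ 2) / 16)) (corrGaussian p q θ) ∧
      ∫ z, Real.exp ((z.1 ^ 2 + z.2 ^ 2) / 16) ∂(corrGaussian p q θ) ≤ 2 := by
  let γ := gaussianReal 0 1
  have hi : Integrable (fun z : ℝ × ℝ => Real.exp (z.1 ^ 2 / 4) * Real.exp (z.2 ^ 2 / 4))
      (γ.prod γ) :=
    integrable_exp_sq_div_four_gaussianReal.mul_prod integrable_exp_sq_div_four_gaussianReal
  have hle : ∀ z : ℝ × ℝ, Real.exp (((p * z.1) ^ 2 +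
      (q * (Real.cos θ * z.1 + Real.sin θ * z.2)) ^ 2) / 16) ≤
      Real.exp (z.1 ^ 2 / 4) * Real.exp (z.2 ^ 2 / 4) := fun z => by
    rw [← Real.exp_add, Real.exp_le_exp]
    have h1 := mul_le_mul_of_nonneg_right hp (sq_nonneg z.1)
    have h2 : (Real.cos θ * z.1 + Real.sin θ * z.2) ^ 2 ≤ z.1 ^ 2 + z.2 ^ 2 := by
      have := sq_nonneg (Real.cos θ * z.2 - Real.sin θ * z.1)
      linear_combination this + (z.1 ^ 2 + z.2 ^ 2) * Real.cos_sq_add_sin_sq θ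
    have h3 := mul_le_mul_of_nonneg_right hq (sq_nonneg (Real.cos θ * z.1 + Real.sin θ * z.2))
    have h4 := sq_nonneg z.2
    have h5 := sq_nonneg z.1
    rw [mul_pow, mul_pow]
    linarith
  have hi' : Integrable (fun z : ℝ × ℝ => Real.exp (((p * z.1) ^ 2 +
      (q * (Real.cos θ * z.1 + Real.sin θ * z.2)) ^ 2) / 16)) (γ.prod γ) := by
    refine hi.mono' (by fun_prop) (Filter.Eventually.of_forall fun z => ?_)
    rw [Real.norm_eq_abs, abs_of_pos (Real.exp_pos _)]
    exact hle z
  rw [corrGaussian, integral_map (by fun_prop) (by fun_prop),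
    integrable_map_measure (by fun_prop) (by fun_prop)]
  refine ⟨hi', (integral_mono hi' hi hle).trans_eq ?_⟩
  rw [integral_prod_mul (fun x : ℝ => Real.exp (x ^ 2 / 4)) (fun x : ℝ => Real.exp (x ^ 2 / 4)),
    integral_exp_sq_div_four_gaussianReal, Real.mul_self_sqrt (by norm_num)]

/-- The linear term is kept exact because it will integrate to zero for a centred variable. -/
theorem Real.exp_le_one_add_add_sq_mul_exp_abs (x : ℝ) :
    Real.exp x ≤ 1 + x + x ^ 2 * Real.exp |x| := by
  have := Complex.norm_exp_sub_sum_le_norm_mul_exp (x : ℂ) 2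
  simp only [Finset.sum_range_succ, Finset.sum_range_zero, pow_zero, Nat.factorial_zero,
    Nat.cast_one, div_one, zero_add, pow_one, Nat.factorial_one, Complex.norm_real] at this
  rw [← Complex.ofReal_exp, ← Complex.ofReal_one, ← Complex.ofReal_add, ← Complex.ofReal_sub,
    Complex.norm_real, Real.norm_eq_abs, Real.norm_eq_abs, sq_abs] at this
  linarith [le_abs_self (Real.exp x - (1 + x))]

theorem two_mul_max_mul_max_le (x y : ℝ) : 2 * (max x 0 * max y 0) ≤ x ^ 2 + y ^ 2 := by
  have h : ∀ x : ℝ, max x 0 ^ 2 ≤ x ^ 2 := fun x => by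
    rcases le_total x 0 with hx | hx
    · rw [max_eq_right hx]; nlinarith [sq_nonneg x]
    · rw [max_eq_left hx]
  nlinarith [h x, h y, sq_nonneg (max x 0 - max y 0)]

section MGF

variable {p q θ : ℝ}

theorem exp_mul_relu_sub_le {m s : ℝ} (hm0 : 0 ≤ m) (hm : m ≤ 2) (hs : |s| ≤ 1 / 32)
    (z : ℝ × ℝ) :
    Real.exp (s * (2 * (max z.1 0 * max z.2 0) - m)) ≤
      1 + s * (2 * (max z.1 0 * max z.2 0) - m) +
        4096 * s ^ 2 * Real.exp ((z.1 ^ 2 + z.2 ^ 2) / 16) := by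
  set D := 2 * (max z.1 0 * max z.2 0) - m with hD
  have hD' : |D| ≤ 2 + (z.1 ^ 2 + z.2 ^ 2) := by
    have h1 := two_mul_max_mul_max_le z.1 z.2
    have h2 : 0 ≤ max z.1 0 * max z.2 0 := by positivity
    rw [abs_le]
    constructor <;> nlinarith [sq_nonneg z.1, sq_nonneg z.2]
  have hsD : |s * D| ≤ |D| / 32 := by
    rw [abs_mul]
    nlinarith [abs_nonneg D]
  -- From x²/2 ≤ exp x at x = |D|/32. This absorbs the square of the Taylor remainder at the price
  -- of another |D|/32 in the exponent.
  have hsq : D ^ 2 ≤ 2048 * Real.exp (|D| / 32) := by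
    have := Real.quadratic_le_exp_of_nonneg (x := |D| / 32) (by positivity)
    have h' := sq_abs D
    nlinarith [abs_nonneg D]
  have hexp : Real.exp (|D| / 32) * Real.exp |s * D| ≤
      2 * Real.exp ((z.1 ^ 2 + z.2 ^ 2) / 16) := by
    have h2 : Real.exp (1 / 8) ≤ 2 := by
      have h3 : (1 : ℝ) / 8 ≤ Real.log 2 := by linarith [Real.log_two_gt_d9]
      calc Real.exp (1 / 8) ≤ Real.exp (Real.log 2) := Real.exp_le_exp.2 h3
        _ = 2 := Real.exp_log two_pos
    calc Real.exp (|D| / 32) * Real.exp |s * D|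
        ≤ Real.exp (1 / 8) * Real.exp ((z.1 ^ 2 + z.2 ^ 2) / 16) := by
          rw [← Real.exp_add, ← Real.exp_add, Real.exp_le_exp]
          linarith
      _ ≤ _ := by gcongr
  calc Real.exp (s * D) ≤ 1 + s * D + (s * D) ^ 2 * Real.exp |s * D| :=
        Real.exp_le_one_add_add_sq_mul_exp_abs _
    _ ≤ 1 + s * D + s ^ 2 * (2048 * (Real.exp (|D| / 32) * Real.exp |s * D|)) := by
        rw [mul_pow, mul_assoc, ← mul_assoc 2048]
        gcongr
    _ ≤ 1 + s * D + s ^ 2 * (2048 * (2 * Real.exp ((z.1 ^ 2 + z.2 ^ 2) / 16))) := by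
        gcongr
    _ = _ := by ring

theorem integrable_relu_mul_relu_corrGaussian (hp : p ^ 2 ≤ 2) (hq : q ^ 2 ≤ 2) :
    Integrable (fun z => 2 * (max z.1 0 * max z.2 0)) (corrGaussian p q θ) := by
  refine ((integrable_exp_corrGaussian_and_integral_le θ hp hq).1.const_mul 16).mono'
    (by fun_prop) (Filter.Eventually.of_forall fun z => ?_)
  rw [Real.norm_eq_abs, abs_of_nonneg (by positivity)]
  linarith [two_mul_max_mul_max_le z.1 z.2, Real.add_one_le_exp ((z.1 ^ 2 + z.2 ^ 2) / 16)]

theorem mul_arcCosKernel_mem_Icc (hp0 : 0 ≤ p) (hq0 : 0 ≤ q) (hp : p ^ 2 ≤ 2) (hq : q ^ 2 ≤ 2)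
    (hθ : θ ∈ Set.Icc 0 Real.pi) : p * q * arcCosKernel θ ∈ Set.Icc 0 2 := by
  constructor
  · rw [← integral_relu_mul_relu_corrGaussian hp0 hq0 hθ]
    exact integral_nonneg fun z => by positivity
  · have h1 : p * q ≤ 2 := by nlinarith [sq_nonneg (p - q)]
    calc p * q * arcCosKernel θ ≤ p * q * 1 := by gcongr; exact arcCosKernel_le_one hθ
      _ ≤ 2 := by linarith

/-- The centred product of two rectified Gaussians is subexponential. -/
theorem integrable_exp_relu_and_integral_le (hp0 : 0 ≤ p) (hq0 : 0 ≤ q) (hp : p ^ 2 ≤ 2)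
    (hq : q ^ 2 ≤ 2) (hθ : θ ∈ Set.Icc 0 Real.pi) {s : ℝ} (hs : |s| ≤ 1 / 32) :
    Integrable (fun z => Real.exp
      (s * (2 * (max z.1 0 * max z.2 0) - p * q * arcCosKernel θ))) (corrGaussian p q θ) ∧
    ∫ z, Real.exp (s * (2 * (max z.1 0 * max z.2 0) - p * q * arcCosKernel θ))
      ∂(corrGaussian p q θ) ≤ Real.exp (8192 * s ^ 2) := by
  obtain ⟨hm0, hm⟩ := mul_arcCosKernel_mem_Icc hp0 hq0 hp hq hθ
  obtain ⟨hi, hle⟩ := integrable_exp_corrGaussian_and_integral_le θ hp hq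
  have hR := integrable_relu_mul_relu_corrGaussian (θ := θ) hp hq
  have hE := integral_relu_mul_relu_corrGaussian hp0 hq0 hθ
  set m := p * q * arcCosKernel θ
  have hlin : Integrable (fun z : ℝ × ℝ => 1 + s * (2 * (max z.1 0 * max z.2 0) - m))
      (corrGaussian p q θ) :=
    (integrable_const _).add ((hR.sub (integrable_const _)).const_mul _)
  have hb := hlin.add (hi.const_mul (4096 * s ^ 2))
  have hint : Integrable (fun z : ℝ × ℝ => Real.exp (s * (2 * (max z.1 0 * max z.2 0) - m)))
      (corrGaussian p q θ) := by
    refine hb.mono' (by fun_prop) (Filter.Eventually.of_forall fun z => ?_)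
    rw [Real.norm_eq_abs, abs_of_pos (Real.exp_pos _)]
    exact exp_mul_relu_sub_le hm0 hm hs z
  refine ⟨hint, (integral_mono hint hb fun z => exp_mul_relu_sub_le hm0 hm hs z).trans ?_⟩
  have h₁ : ∫ z : ℝ × ℝ, (1 + s * (2 * (max z.1 0 * max z.2 0) - m)) ∂(corrGaussian p q θ) =
      1 := by
    rw [integral_add (integrable_const _) (by exact (hR.sub (integrable_const _)).const_mul _),
      integral_const_mul, integral_sub hR (integrable_const _), hE]
    simp
  -- The centred part contributes 1 and the remainder at most 4096 s² · 2.
  rw [integral_add' hlin (hi.const_mul _), integral_const_mul, h₁]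
  nlinarith [Real.add_one_le_exp (8192 * s ^ 2), sq_nonneg s]

end MGF

/-! ### Chernoff bound for the mean over `r` neurons -/

section Concentration

variable {Ω : Type*} [MeasurableSpace Ω] {P : Measure Ω} {r : ℕ} {X Y : Fin r → Ω → ℝ}
  {p q θ : ℝ}

theorem measureReal_sum_relu_ge_le (hX : ∀ i, Measurable (X i)) (hY : ∀ i, Measurable (Y i))
    (hind : iIndepFun (fun i ω => (X i ω, Y i ω)) P)
    (hlaw : ∀ i, P.map (fun ω => (X i ω, Y i ω)) = corrGaussian p q θ)
    (hp0 : 0 ≤ p) (hq0 : 0 ≤ q) (hp : p ^ 2 ≤ 2) (hq : q ^ 2 ≤ 2)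
    (hθ : θ ∈ Set.Icc 0 Real.pi) {s t : ℝ} (hs : |s| = 1) (ht0 : 0 ≤ t) (ht : t ≤ 1) :
    P.real {ω | r * t ≤ ∑ i, s * (2 * (max (X i ω) 0 * max (Y i ω) 0) -
      p * q * arcCosKernel θ)} ≤ Real.exp (-(r * t ^ 2 / 32768)) := by
  have := hind.isProbabilityMeasure
  set m := p * q * arcCosKernel θ with hm
  let g : ℝ × ℝ → ℝ := fun z => s * (2 * (max z.1 0 * max z.2 0) - m)
  have hg : Measurable g := by fun_prop
  let E : Fin r → Ω → ℝ := fun i ω => g (X i ω, Y i ω)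
  have hE : ∀ i, Measurable (E i) := fun i => hg.comp ((hX i).prodMk (hY i))
  have hEind : iIndepFun E P := hind.comp (fun _ => g) fun _ => hg
  -- The minimizer of 8192 l² - l t, with minimum -t²/32768; t ≤ 1 keeps it in the range of the
  -- moment bound. The sign `s` serves both tails.
  set l := t / 16384 with hl
  have hl0 : 0 ≤ l := by positivity
  have hls : |l * s| ≤ 1 / 32 := by
    rw [abs_mul, hs, abs_of_nonneg hl0]
    linarith
  obtain ⟨hi, hle⟩ := integrable_exp_relu_and_integral_le hp0 hq0 hp hq hθ hls
  have hsq : (l * s) ^ 2 = l ^ 2 := by rw [mul_pow, ← sq_abs s, hs]; ring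
  rw [hsq] at hle
  have hcomp : ∀ z : ℝ × ℝ, Real.exp (l * g z) =
      Real.exp (l * s * (2 * (max z.1 0 * max z.2 0) - m)) := fun z => by
    simp only [g, mul_assoc]
  have hint : ∀ i, Integrable (fun ω => Real.exp (l * E i ω)) P := fun i => by
    have := hi
    rw [← hlaw i, integrable_map_measure (by fun_prop)
      ((hX i).prodMk (hY i)).aemeasurable] at this
    exact this.congr (Filter.Eventually.of_forall fun ω => (hcomp _).symm)
  have hmgf : ∀ i, mgf (E i) P l ≤ Real.exp (8192 * l ^ 2) := fun i => by
    refine le_trans (le_of_eq ?_) hle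
    rw [← hlaw i, integral_map ((hX i).prodMk (hY i)).aemeasurable (by fun_prop)]
    exact integral_congr_ae (Filter.Eventually.of_forall fun ω => hcomp _)
  have hsum : mgf (∑ i, E i) P l ≤ Real.exp (8192 * l ^ 2) ^ r := by
    rw [hEind.mgf_sum hE]
    refine (Finset.prod_le_prod (fun i _ => mgf_nonneg) fun i _ => hmgf i).trans_eq ?_
    simp
  have hch := measure_ge_le_exp_mul_mgf (μ := P) (X := ∑ i, E i) (r * t) hl0
    (hEind.integrable_exp_mul_sum hE fun i _ => hint i)
  have hset : {ω | r * t ≤ ∑ i, s * (2 * (max (X i ω) 0 * max (Y i ω) 0) - m)} =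
      {ω | r * t ≤ (∑ i, E i) ω} := by
    ext ω
    simp [E, g]
  rw [hset]
  refine hch.trans ((mul_le_mul_of_nonneg_left hsum (Real.exp_pos _).le).trans_eq ?_)
  rw [← Real.exp_nat_mul, ← Real.exp_add]
  congr 1
  rw [hl]
  ring

/-- Concentration of the empirical mean of products of rectified Gaussians. -/
theorem measureReal_mean_relu_sub_ge_le (hr : r ≠ 0) (hX : ∀ i, Measurable (X i))
    (hY : ∀ i, Measurable (Y i))
    (hind : iIndepFun (fun i ω => (X i ω, Y i ω)) P)
    (hlaw : ∀ i, P.map (fun ω => (X i ω, Y i ω)) = corrGaussian p q θ)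
    (hp0 : 0 ≤ p) (hq0 : 0 ≤ q) (hp : p ^ 2 ≤ 2) (hq : q ^ 2 ≤ 2)
    (hθ : θ ∈ Set.Icc 0 Real.pi) {t : ℝ} (ht0 : 0 ≤ t) (ht : t ≤ 1) :
    P.real {ω | t ≤ |(∑ i, 2 * (max (X i ω) 0 * max (Y i ω) 0)) / r -
      p * q * arcCosKernel θ|} ≤ 2 * Real.exp (-(r * t ^ 2 / 32768)) := by
  have := hind.isProbabilityMeasure
  have h₁ := measureReal_sum_relu_ge_le hX hY hind hlaw hp0 hq0 hp hq hθ (s := 1)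
    (by simp) ht0 ht
  have h₂ := measureReal_sum_relu_ge_le hX hY hind hlaw hp0 hq0 hp hq hθ (s := -1)
    (by simp) ht0 ht
  rw [two_mul]
  refine le_trans ?_ (add_le_add h₁ h₂)
  refine (measureReal_mono ?_).trans (measureReal_union_le _ _)
  intro ω hω
  have hr' : (0 : ℝ) < r := by positivity
  simp only [Set.mem_ofPred_eq, Set.mem_union, ← Finset.mul_sum, Finset.sum_sub_distrib,
    Finset.sum_const, Finset.card_univ, Fintype.card_fin, nsmul_eq_mul] at hω ⊢
  have e : (2 * ∑ i, max (X i ω) 0 * max (Y i ω) 0) / r - p * q * arcCosKernel θ =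
      (2 * ∑ i, max (X i ω) 0 * max (Y i ω) 0 - r * (p * q * arcCosKernel θ)) / r := by
    field_simp
  rw [e, abs_div, abs_of_pos hr', le_div_iff₀ hr', le_abs] at hω
  rcases hω with h | h
  · left; linarith
  · right; linarith

end Concentration

/-! ### Conditioning by resampling coordinates -/

section Resampling

theorem measurable_piecewise_prod {ι : Type*} {α : ι → Type*} [∀ i, MeasurableSpace (α i)]
    (s : Set ι) [DecidablePred (· ∈ s)] :
    Measurable fun z : (∀ i, α i) × (∀ i, α i) => s.piecewise z.1 z.2 := by
  refine measurable_pi_lambda _ fun i => ?_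
  by_cases h : i ∈ s
  · simp only [Set.piecewise_eq_of_mem _ _ _ h]; fun_prop
  · simp only [Set.piecewise_eq_of_notMem _ _ _ h]; fun_prop

variable {ι : Type*} [Fintype ι] {α : ι → Type*} [∀ i, MeasurableSpace (α i)]
  (μ : ∀ i, Measure (α i)) [∀ i, IsProbabilityMeasure (μ i)] (s : Set ι)
  [DecidablePred (· ∈ s)]

/-- Resampling a set of coordinates of a product measure preserves the measure. -/
theorem map_piecewise_prod_pi :
    ((Measure.pi μ).prod (Measure.pi μ)).map (fun z => s.piecewise z.1 z.2) =
      Measure.pi μ := by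
  refine (Measure.pi_eq fun A hA => ?_).symm
  have hpre : (fun z : (∀ i, α i) × (∀ i, α i) => s.piecewise z.1 z.2) ⁻¹' Set.univ.pi A =
      (Set.univ.pi fun i => if i ∈ s then A i else Set.univ) ×ˢ
        (Set.univ.pi fun i => if i ∈ s then Set.univ else A i) := by
    ext z
    simp only [Set.mem_preimage, Set.mem_univ_pi, Set.mem_prod, ← forall_and]
    refine forall_congr' fun i => ?_
    by_cases h : i ∈ s <;> simp [h]
  rw [Measure.map_apply (measurable_piecewise_prod s) (MeasurableSet.univ_pi hA), hpre,
    Measure.prod_prod, Measure.pi_pi, Measure.pi_pi, ← Finset.prod_mul_distrib]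
  refine Finset.prod_congr rfl fun i _ => ?_
  by_cases h : i ∈ s <;> simp [h]

/-- Fubini in place of conditional probability: the coordinates in `s` are drawn afresh, the others
are frozen at `w`. -/
theorem measureReal_pi_le_of_forall_piecewise {A : Set (∀ i, α i)} (hA : MeasurableSet A)
    {C : ℝ} (hC : 0 ≤ C)
    (h : ∀ w, (Measure.pi μ).real {w' | s.piecewise w' w ∈ A} ≤ C) :
    (Measure.pi μ).real A ≤ C := by
  refine ENNReal.toReal_le_of_le_ofReal hC ?_
  conv_lhs => rw [← map_piecewise_prod_pi μ s]
  rw [Measure.map_apply (measurable_piecewise_prod s) hA,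
    Measure.prod_apply_symm (measurable_piecewise_prod s hA)]
  calc ∫⁻ w, Measure.pi μ ((fun w' => (w', w)) ⁻¹'
        ((fun z : (∀ i, α i) × (∀ i, α i) => s.piecewise z.1 z.2) ⁻¹' A)) ∂(Measure.pi μ)
      ≤ ∫⁻ _, ENNReal.ofReal C ∂(Measure.pi μ) :=
        lintegral_mono fun w => (ENNReal.le_ofReal_iff_toReal_le (measure_ne_top _ _) hC).2 (h w)
    _ = ENNReal.ofReal C := by simp

end Resampling

/-! ### Linear forms in independent Gaussians -/

section LinearForms

variable {ι : Type*} [Fintype ι] (v : ι → ℝ≥0)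

theorem hasLaw_eval_pi_gaussianReal (i : ι) :
    HasLaw (fun w : ι → ℝ => w i) (gaussianReal 0 (v i))
      (Measure.pi fun i => gaussianReal 0 (v i)) :=
  ⟨Measurable.aemeasurable (by fun_prop),
    (measurePreserving_eval (fun i => gaussianReal 0 (v i)) i).map_eq⟩

theorem hasGaussianLaw_pi_gaussianReal :
    HasGaussianLaw (fun (w : ι → ℝ) i => w i) (Measure.pi fun i => gaussianReal 0 (v i)) := by
  refine iIndepFun.hasGaussianLaw (fun i => ?_)
    (iIndepFun_pi (X := fun _ x => x) fun _ => aemeasurable_id)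
  exact (hasLaw_eval_pi_gaussianReal v i).hasGaussianLaw

theorem integral_linearForm_pi_gaussianReal (A : ι → ℝ) :
    ∫ w, ∑ i, A i * w i ∂(Measure.pi fun i => gaussianReal 0 (v i)) = 0 := by
  have h := hasGaussianLaw_pi_gaussianReal v
  rw [integral_finsetSum _ fun i _ => (h.eval i).integrable.const_mul _]
  refine Finset.sum_eq_zero fun i _ => ?_
  rw [integral_const_mul, (hasLaw_eval_pi_gaussianReal v i).integral_eq,
    integral_id_gaussianReal, mul_zero]

theorem covariance_linearForm_pi_gaussianReal (A B : ι → ℝ) :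
    cov[fun w : ι → ℝ => ∑ i, A i * w i, fun w => ∑ i, B i * w i;
      Measure.pi fun i => gaussianReal 0 (v i)] = ∑ i, A i * B i * v i := by
  classical
  have h := hasGaussianLaw_pi_gaussianReal v
  rw [covariance_fun_sum_fun_sum (fun i => (h.eval i).memLp_two.const_mul _)
    fun i => (h.eval i).memLp_two.const_mul _]
  refine Finset.sum_congr rfl fun i _ => ?_
  have hind := iIndepFun_pi (μ := fun i => gaussianReal 0 (v i)) (X := fun _ x => x)
    fun _ => aemeasurable_id
  rw [Finset.sum_eq_single i]
  · rw [covariance_const_mul_left, covariance_const_mul_right,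
      covariance_self (h.eval i).aemeasurable,
      (hasLaw_eval_pi_gaussianReal v i).variance_eq, variance_id_gaussianReal]
    ring
  · intro j _ hj
    rw [covariance_const_mul_left, covariance_const_mul_right,
      (hind.indepFun hj.symm).covariance_eq_zero (h.eval i).memLp_two (h.eval j).memLp_two]
    simp
  · simp

/-- Concentration of the empirical mean of products of rectified linear forms with disjoint
supports in independent Gaussian variables. -/
theorem exists_measureReal_mean_relu_linearForm_sub_ge_le {r : ℕ} (hr : r ≠ 0)
    (A B : Fin r → ι → ℝ) {a b c : ℝ}
    (hdisj : ∀ k l, k ≠ l → ∀ i, (A k i = 0 ∧ B k i = 0) ∨ (A l i = 0 ∧ B l i = 0))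
    (ha : ∀ k, ∑ i, A k i * A k i * v i = a) (hb : ∀ k, ∑ i, A k i * B k i * v i = b)
    (hc : ∀ k, ∑ i, B k i * B k i * v i = c) (ha2 : a ≤ 2) (hc2 : c ≤ 2) :
    0 ≤ a ∧ 0 ≤ c ∧ ∃ θ ∈ Set.Icc 0 Real.pi, b = √a * √c * Real.cos θ ∧
      ∀ t, 0 ≤ t → t ≤ 1 → (Measure.pi fun i => gaussianReal 0 (v i)).real
        {w | t ≤ |(∑ k, 2 * (max (∑ i, A k i * w i) 0 * max (∑ i, B k i * w i) 0)) / r -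
          √a * √c * arcCosKernel θ|} ≤ 2 * Real.exp (-(r * t ^ 2 / 32768)) := by
  set P := Measure.pi fun i => gaussianReal 0 (v i)
  let M : Fin r → Fin 2 → ι → ℝ := fun k => ![A k, B k]
  have hjoint : HasGaussianLaw (fun w k j => ∑ i, M k j i * w i) P :=
    (hasGaussianLaw_pi_gaussianReal v).map_fun (LinearMap.toContinuousLinearMap
      { toFun := fun (w : ι → ℝ) (k : Fin r) (j : Fin 2) => ∑ i, M k j i * w i
        map_add' := fun w w' => by ext; simp [mul_add, Finset.sum_add_distrib]
        map_smul' := fun x w => by ext; simp [Finset.mul_sum, mul_left_comm] })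
  have hpair : ∀ k, HasGaussianLaw
      (fun w : ι → ℝ => (∑ i, A k i * w i, ∑ i, B k i * w i)) P := fun k =>
    (hjoint.eval k).prodMk 0 1
  -- Disjoint supports make the cross-covariances vanish, which for jointly Gaussian vectors is
  -- independence.
  have hind : iIndepFun (fun k (w : ι → ℝ) => (∑ i, A k i * w i, ∑ i, B k i * w i)) P := by
    refine (hjoint.iIndepFun_of_covariance_eval fun k l hkl j j' => ?_).comp
      (fun _ f => (f 0, f 1)) fun _ => by fun_prop
    rw [covariance_linearForm_pi_gaussianReal]
    refine Finset.sum_eq_zero fun i _ => ?_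
    rcases hdisj k l hkl i with h | h
    · have : M k j i = 0 := by fin_cases j <;> simp [M, h.1, h.2]
      simp [this]
    · have : M l j' i = 0 := by fin_cases j' <;> simp [M, h.1, h.2]
      simp [this]
  have vA : ∀ k, Var[fun w : ι → ℝ => ∑ i, A k i * w i; P] = a := fun k => by
    rw [← covariance_self (Measurable.aemeasurable (by fun_prop)),
      covariance_linearForm_pi_gaussianReal, ha]
  have vB : ∀ k, Var[fun w : ι → ℝ => ∑ i, B k i * w i; P] = c := fun k => by
    rw [← covariance_self (Measurable.aemeasurable (by fun_prop)),
      covariance_linearForm_pi_gaussianReal, hc]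
  have cAB : ∀ k, cov[fun w : ι → ℝ => ∑ i, A k i * w i, fun w => ∑ i, B k i * w i; P] = b :=
    fun k => by rw [covariance_linearForm_pi_gaussianReal, hb]
  -- All `k` share the same a, b, c, so one index suffices for their positivity and for the angle.
  let k₀ : Fin r := ⟨0, Nat.pos_of_ne_zero hr⟩
  have ha0 : 0 ≤ a := vA k₀ ▸ variance_nonneg _ _
  have hc0 : 0 ≤ c := vB k₀ ▸ variance_nonneg _ _
  have hcs := covariance_sq_le (hpair k₀)
  rw [vA, vB, cAB] at hcs
  obtain ⟨θ, hθ, hbθ⟩ := exists_angle ha0 hcs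
  refine ⟨ha0, hc0, θ, hθ, hbθ, fun t ht0 ht => ?_⟩
  refine measureReal_mean_relu_sub_ge_le hr (fun k => by fun_prop) (fun k => by fun_prop) hind
    (fun k => ?_) (Real.sqrt_nonneg a) (Real.sqrt_nonneg c) (by rwa [Real.sq_sqrt ha0])
    (by rwa [Real.sq_sqrt hc0]) hθ ht0 ht
  exact map_prodMk_eq_corrGaussian (hpair k) (integral_linearForm_pi_gaussianReal v _)
    (integral_linearForm_pi_gaussianReal v _) (by rw [vA, Real.sq_sqrt ha0])
    (by rw [vB, Real.sq_sqrt hc0]) (by rw [cAB, hbθ])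

end LinearForms

/-! ### ReLU activations and their dual -/

theorem integral_sq_max_gaussianReal :
    ∫ x, (max x 0) ^ 2 ∂(gaussianReal 0 1) = 1 / 2 := by
  have h := integral_relu_mul_relu_gaussian_prod (θ := 0) ⟨le_rfl, Real.pi_nonneg⟩
  simp only [Real.cos_zero, one_mul, Real.sin_zero, zero_mul, add_zero, arcCosKernel_zero] at h
  rw [integral_fun_fst (μ := gaussianReal 0 1) (ν := gaussianReal 0 1)
    (f := fun x => 2 * (max x 0 * max x 0)), integral_const_mul] at h
  simp only [probReal_univ, one_smul, ← pow_two] at h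
  linarith

namespace IsReLU

variable {σ : ℝ → ℝ}

theorem continuous (h : IsReLU σ) : Continuous σ := by
  obtain ⟨a, -, h⟩ := h
  rw [funext h]
  fun_prop

/-- The scale of the activation cancels, so all later estimates concern the single function 2 max(x,
0) max(y, 0). -/
theorem mul_div_actNorm_sq (h : IsReLU σ) (x y : ℝ) :
    σ x * σ y / actNorm σ ^ 2 = 2 * (max x 0 * max y 0) := by
  obtain ⟨a, ha, h⟩ := h
  have : ∫ x, σ x ^ 2 ∂(gaussianReal 0 1) = a ^ 2 / 2 := by
    simp_rw [h, mul_pow]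
    rw [integral_const_mul, integral_sq_max_gaussianReal]
    ring
  rw [actNorm, Real.sq_sqrt (by rw [this]; positivity), this, h, h]
  field_simp

end IsReLU

theorem posSemidef_correlation {ρ : ℝ} (h : |ρ| ≤ 1) : (!![1, ρ; ρ, 1]).PosSemidef := by
  obtain ⟨h1, h2⟩ := abs_le.1 h
  refine Matrix.PosSemidef.of_dotProduct_mulVec_nonneg ?_ fun x => ?_
  · ext i j; fin_cases i <;> fin_cases j <;> simp
  · simp [Matrix.mulVec, dotProduct, Fin.sum_univ_two]
    nlinarith [mul_nonneg (sub_nonneg.2 h2) (sq_nonneg (x 0 - x 1)),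
      mul_nonneg (by linarith : 0 ≤ 1 + ρ) (sq_nonneg (x 0 + x 1)),
      sq_nonneg (x 0 - x 1), sq_nonneg (x 0 + x 1)]

theorem map_gaussianPair_eq_corrGaussian (θ : ℝ) :
    (gaussianPair (Real.cos θ)).map (fun z => (z 0, z 1)) = corrGaussian 1 1 θ := by
  have hS := posSemidef_correlation (Real.abs_cos_le_one θ)
  have hG : HasGaussianLaw (fun z : EuclideanSpace ℝ (Fin 2) => (z 0, z 1))
      (gaussianPair (Real.cos θ)) :=
    (IsGaussian.hasGaussianLaw_id
      (μ := multivariateGaussian 0 !![1, Real.cos θ; Real.cos θ, 1])).map_fun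
      ((EuclideanSpace.proj 0).prod (EuclideanSpace.proj 1))
  have hm : ∀ i, ∫ z, z i ∂(gaussianPair (Real.cos θ)) = 0 := fun i => by
    have h : HasLaw (fun z : EuclideanSpace ℝ (Fin 2) => z i) _ (gaussianPair (Real.cos θ)) :=
      (measurePreserving_eval_multivariateGaussian hS).hasLaw
    rw [h.integral_eq, integral_id_gaussianReal]
    rfl
  refine map_prodMk_eq_corrGaussian hG (hm 0) (hm 1) ?_ ?_ ?_
  · rw [gaussianPair, variance_eval_multivariateGaussian hS]; simp
  · rw [gaussianPair, variance_eval_multivariateGaussian hS]; simp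
  · rw [gaussianPair, covariance_eval_multivariateGaussian hS]; simp

theorem IsReLU.dualAct_normalizedAct_cos {σ : ℝ → ℝ} (h : IsReLU σ) {θ : ℝ}
    (hθ : θ ∈ Set.Icc 0 Real.pi) :
    dualAct (normalizedAct σ) (Real.cos θ) = arcCosKernel θ := by
  have e : ∀ z : EuclideanSpace ℝ (Fin 2), normalizedAct σ (z 0) * normalizedAct σ (z 1) =
      2 * (max (z 0) 0 * max (z 1) 0) := fun z => by
    rw [← h.mul_div_actNorm_sq, normalizedAct, normalizedAct]
    ring
  simp_rw [dualAct, e]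
  have := integral_relu_mul_relu_corrGaussian zero_le_one zero_le_one hθ
  rw [← map_gaussianPair_eq_corrGaussian, integral_map (Measurable.aemeasurable (by fun_prop))
    (by fun_prop), one_mul, one_mul] at this
  exact this

theorem abs_arcCosKernel_le_one {θ : ℝ} (hθ : θ ∈ Set.Icc 0 Real.pi) :
    |arcCosKernel θ| ≤ 1 := by
  have := (mul_arcCosKernel_mem_Icc zero_le_one zero_le_one (by norm_num) (by norm_num) hθ).1
  rw [one_mul, one_mul] at this
  rw [abs_of_nonneg this]
  exact arcCosKernel_le_one hθ

theorem abs_sum_div_card_le {ι : Type*} [Fintype ι] {f : ι → ℝ} {C : ℝ} (hC : 0 ≤ C)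
    (h : ∀ i, |f i| ≤ C) : |(∑ i, f i) / Fintype.card ι| ≤ C := by
  rw [abs_div, Nat.abs_cast]
  refine div_le_of_le_mul₀ (by positivity) hC ?_
  refine (Finset.abs_sum_le_sum_abs _ _).trans ((Finset.sum_le_sum fun i _ => h i).trans_eq ?_)
  simp [mul_comm]

/-! ### The compositional kernel for ReLU -/

namespace ComputationSkeleton

variable {n d : ℕ} {I U : Type*} [Fintype I] [Fintype U] (S : ComputationSkeleton n I U)

theorem nodeKernel_inl (x x' : InputSpace n d) (i : I) :
    S.nodeKernel x x' (.inl i) = ⟪(x (S.coord i) : EuclideanSpace ℝ (Fin d)),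
      (x' (S.coord i) : EuclideanSpace ℝ (Fin d))⟫ := rfl

open scoped Classical in
theorem nodeKernel_inr (x x' : InputSpace n d) (v : U) :
    S.nodeKernel x x' (.inr v) = dualAct (normalizedAct (S.act v))
      ((∑ u : S.In v, S.nodeKernel x x' u.1) / Fintype.card (S.In v)) :=
  S.propagate_inr _ _ v

open scoped Classical in
/-- The average of the kernels of the nodes incoming to `v`. -/
noncomputable def inKernel (x x' : InputSpace n d) (v : U) : ℝ :=
  (∑ u : S.In v, S.nodeKernel x x' u.1) / Fintype.card (S.In v)

variable {S}

-- Needed so that the arccosine of an averaged kernel is a genuine angle; the bound propagates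
-- because the arc-cosine kernel has modulus at most 1.
open scoped Classical in
theorem abs_nodeKernel_le_one (hS : ∀ v, IsReLU (S.act v)) (x x' : InputSpace n d)
    (u : I ⊕ U) : |S.nodeKernel x x' u| ≤ 1 := by
  rcases u with i | v
  · refine (abs_real_inner_le_norm _ _).trans ?_
    simp
  · induction v using S.wellFounded.induction with
    | _ v ih =>
      have hav : |S.inKernel x x' v| ≤ 1 := by
        refine abs_sum_div_card_le zero_le_one ?_
        rintro ⟨u | u, hu⟩
        · refine (abs_real_inner_le_norm _ _).trans ?_
          simp
        · exact ih u hu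
      obtain ⟨h1, h2⟩ := abs_le.1 hav
      have hθ : Real.arccos (S.inKernel x x' v) ∈ Set.Icc 0 Real.pi :=
        ⟨Real.arccos_nonneg _, Real.arccos_le_pi _⟩
      rw [nodeKernel_inr, ← inKernel, ← Real.cos_arccos h1 h2,
        (hS v).dualAct_normalizedAct_cos hθ]
      exact abs_arcCosKernel_le_one hθ

open scoped Classical in
theorem abs_inKernel_le_one (hS : ∀ v, IsReLU (S.act v)) (x x' : InputSpace n d) (v : U) :
    |S.inKernel x x' v| ≤ 1 :=
  abs_sum_div_card_le zero_le_one fun u => abs_nodeKernel_le_one hS x x' u.1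

theorem nodeKernel_inr_eq_arcCosKernel (hS : ∀ v, IsReLU (S.act v)) (x x' : InputSpace n d)
    (v : U) : S.nodeKernel x x' (.inr v) = arcCosKernel (Real.arccos (S.inKernel x x' v)) := by
  obtain ⟨h1, h2⟩ := abs_le.1 (abs_inKernel_le_one hS x x' v)
  have hθ : Real.arccos (S.inKernel x x' v) ∈ Set.Icc 0 Real.pi :=
    ⟨Real.arccos_nonneg _, Real.arccos_le_pi _⟩
  rw [← (hS v).dualAct_normalizedAct_cos hθ, Real.cos_arccos h1 h2, nodeKernel_inr, ← inKernel]

open scoped Classical in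
theorem card_in_pos (S : ComputationSkeleton n I U) (v : U) :
    0 < (Fintype.card (S.In v) : ℝ) := by
  obtain ⟨u, hu⟩ := S.exists_edge v
  have : Nonempty (S.In v) := ⟨⟨u, hu⟩⟩
  exact_mod_cast Fintype.card_pos

/-- Correlation 1 is a fixed point of the dual activation. The limiting covariances thus have unit
diagonal, the place where nonexpansiveness is applied. -/
theorem nodeKernel_self (hS : ∀ v, IsReLU (S.act v)) (x : InputSpace n d)
    (u : I ⊕ U) : S.nodeKernel x x u = 1 := by
  have hl : ∀ i, S.nodeKernel x x (.inl i) = 1 := fun i => by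
    rw [nodeKernel_inl, real_inner_self_eq_norm_sq]
    simp
  rcases u with i | v
  · exact hl i
  · induction v using S.wellFounded.induction with
    | _ v ih =>
      have hav : S.inKernel x x v = 1 := by
        have h1 : ∀ u : S.In v, S.nodeKernel x x u.1 = 1 := by
          rintro ⟨u | u, hu⟩
          · exact hl u
          · exact ih u hu
        have := S.card_in_pos v
        simp only [inKernel, h1, Finset.sum_const, Finset.card_univ, nsmul_eq_mul, mul_one]
        exact div_self this.ne'
      rw [nodeKernel_inr_eq_arcCosKernel hS, hav, Real.arccos_one, arcCosKernel_zero]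

theorem inKernel_self (hS : ∀ v, IsReLU (S.act v)) (x : InputSpace n d) (v : U) :
    S.inKernel x x v = 1 := by
  have := S.card_in_pos v
  simp only [inKernel, nodeKernel_self hS, Finset.sum_const, Finset.card_univ, nsmul_eq_mul,
    mul_one]
  exact div_self this.ne'

end ComputationSkeleton

/-! ### Dependence of neuron outputs on the weights -/

namespace NeuralNetwork

variable {n d : ℕ} {I U : Type*} [Fintype I] [Fintype U] (N : NeuralNetwork n d I U)

open scoped Classical in
theorem output_inr (w : N.Edge → ℝ) (x : InputSpace n d) (v : U) :
    N.output w x (.inr v) =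
      N.act v (∑ u : N.In v, w ⟨(u.1, v), u.2⟩ * N.output w x u.1) :=
  N.propagate_inr _ _ v

theorem continuous_output (hN : ∀ v, Continuous (N.act v)) (x : InputSpace n d) (u : I ⊕ U) :
    Continuous fun w => N.output w x u := by
  rcases u with i | v
  · exact continuous_const
  · induction v using N.wellFounded.induction with
    | _ v ih =>
      simp_rw [output_inr]
      refine (hN v).comp (continuous_finsetSum _ ?_)
      rintro ⟨u | u, hu⟩ -
      · exact (continuous_apply _).mul continuous_const
      · exact (continuous_apply _).mul (ih u hu)

/-- The output of a neuron depends only on the weights of the edges into its ancestors. -/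
theorem output_congr {w w' : N.Edge → ℝ} (x : InputSpace n d) {T : Set U}
    (hT : ∀ u v, N.edge (.inr u) v → u ∈ T → v ∈ T) (hw : ∀ e : N.Edge, e.1.2 ∉ T → w e = w' e)
    (u : I ⊕ U) (hu : ∀ v ∈ T, u ≠ .inr v) : N.output w x u = N.output w' x u := by
  rcases u with i | v
  · rfl
  · induction v using N.wellFounded.induction with
    | _ v ih =>
      have hv : v ∉ T := fun h => hu v h rfl
      rw [output_inr, output_inr]
      congr 1
      refine Finset.sum_congr rfl ?_
      rintro ⟨u | u, huv⟩ -
      · rw [hw _ hv]; rfl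
      · rw [hw _ hv]
        congr 1
        exact ih u huv fun z hz h => hv (hT u v huv (Sum.inr_injective h ▸ hz))

-- Lets a preactivation be read as a linear form in the whole weight vector.
open scoped Classical in
theorem sum_in_eq_sum_edge (v : U) (f : N.Edge → ℝ) :
    ∑ u : N.In v, f ⟨(u.1, v), u.2⟩ = ∑ e : N.Edge, {e : N.Edge | e.1.2 = v}.indicator f e := by
  refine Fintype.sum_of_injective (fun u : N.In v => (⟨(u.1, v), u.2⟩ : N.Edge)) ?_ _ _ ?_ ?_
  · rintro ⟨u, hu⟩ ⟨u', hu'⟩ h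
    simpa using h
  · rintro ⟨⟨u, v'⟩, he⟩ h
    refine Set.indicator_of_notMem (fun hv => h ?_) _
    obtain rfl : v' = v := hv
    exact ⟨⟨u, he⟩, rfl⟩
  · intro u
    exact (Set.indicator_of_mem (s := {e : N.Edge | e.1.2 = v}) rfl f).symm

theorem inWeight_nonneg (v : U) : 0 ≤ N.inWeight v :=
  Finset.sum_nonneg fun _ _ => NNReal.coe_nonneg _

theorem initVariance_nonneg (e : N.Edge) : 0 ≤ N.initVariance e := by
  have := N.inWeight_nonneg e.1.2
  rw [initVariance]
  split <;> positivity

end NeuralNetwork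

/-! ### Empirical kernels of the realization -/

namespace ComputationSkeleton

variable {n d r : ℕ} [NeZero d] [NeZero r] {I U : Type*} [Fintype I] [Fintype U]
  (S : ComputationSkeleton n I U)

open scoped Classical in
theorem sum_realization_in (v : U) (k : Fin r) (g : (I × Fin d) ⊕ (U × Fin r) → ℝ) :
    ∑ a : (S.realization d r).In (v, k), g a.1 =
      ∑ b : S.In v, Sum.elim (fun i => ∑ j, g (.inl (i, j))) (fun u => ∑ k, g (.inr (u, k)))
        b.1 := by
  have h₁ : ∑ a : (S.realization d r).In (v, k), g a.1 =
      ∑ a : (I × Fin d) ⊕ (U × Fin r),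
        if S.edge (Sum.map Prod.fst Prod.fst a) v then g a else 0 := by
    rw [← Finset.sum_filter]
    exact (Finset.sum_subtype _ (fun a => by simp [realization]) g).symm
  have h₂ : ∀ G : I ⊕ U → ℝ, ∑ b : S.In v, G b.1 = ∑ b, if S.edge b v then G b else 0 :=
    fun G => by
      rw [← Finset.sum_filter]
      exact (Finset.sum_subtype _ (fun a => by simp) G).symm
  rw [h₁, h₂, Fintype.sum_sum_type, Fintype.sum_sum_type, Fintype.sum_prod_type,
    Fintype.sum_prod_type]
  congr 1
  · refine Finset.sum_congr rfl fun i _ => ?_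
    by_cases h : S.edge (.inl i) v <;> simp [h]
  · refine Finset.sum_congr rfl fun i _ => ?_
    by_cases h : S.edge (.inr i) v <;> simp [h]

/-- The empirical kernel of the `r` neurons at a node of the skeleton. -/
noncomputable def empiricalNodeKernel (w : (S.realization d r).Edge → ℝ)
    (x x' : InputSpace n d) : I ⊕ U → ℝ :=
  Sum.elim (fun i => ⟪(x (S.coord i) : EuclideanSpace ℝ (Fin d)),
      (x' (S.coord i) : EuclideanSpace ℝ (Fin d))⟫)
    fun v => (∑ k, (S.realization d r).output w x (.inr (v, k)) *
      (S.realization d r).output w x' (.inr (v, k)) / actNorm (S.act v) ^ 2) / r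

open scoped Classical in
/-- The average of the empirical kernels of the nodes incoming to `v`. -/
noncomputable def empiricalInKernel (w : (S.realization d r).Edge → ℝ)
    (x x' : InputSpace n d) (v : U) : ℝ :=
  (∑ u : S.In v, S.empiricalNodeKernel w x x' u.1) / Fintype.card (S.In v)

theorem continuous_empiricalNodeKernel (hS : ∀ v, IsReLU (S.act v)) (x x' : InputSpace n d)
    (u : I ⊕ U) :
    Continuous fun w : (S.realization d r).Edge → ℝ => S.empiricalNodeKernel w x x' u := by
  have h := (S.realization d r).continuous_output fun v => (hS v.1).continuous
  rcases u with i | v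
  · exact continuous_const
  · exact (continuous_finsetSum _ fun k _ => ((h x _).mul (h x' _)).div_const _).div_const _

-- The `d` or `r` copies of each node have total weight 1.
open scoped Classical in
theorem inWeight_realization (v : U) (k : Fin r) :
    (S.realization d r).inWeight (v, k) = Fintype.card (S.In v) := by
  have hd : (d : ℝ) ≠ 0 := NeZero.ne _
  have hr : (r : ℝ) ≠ 0 := NeZero.ne _
  rw [NeuralNetwork.inWeight,
    S.sum_realization_in v k fun a => ((S.realization d r).weight a : ℝ)]
  have : ∀ b : I ⊕ U, Sum.elim
      (fun i => ∑ j : Fin d, ((S.realization d r).weight (.inl (i, j)) : ℝ))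
      (fun u => ∑ k : Fin r, ((S.realization d r).weight (.inr (u, k)) : ℝ)) b = 1 := by
    rintro (i | u) <;> simp [realization, hd, hr]
  simp only [this]
  simp

-- The initial variances are calibrated for this: with the earlier outputs fixed, the left side is
-- the covariance of the preactivations at the two inputs.
open scoped Classical in
theorem sum_initVariance_mul_output (w : (S.realization d r).Edge → ℝ) (x x' : InputSpace n d)
    (v : U) (k : Fin r) :
    ∑ a : (S.realization d r).In (v, k),
      (S.realization d r).output w x a.1 * (S.realization d r).output w x' a.1 *
        (S.realization d r).initVariance ⟨(a.1, (v, k)), a.2⟩ =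
      S.empiricalInKernel w x x' v := by
  have hd : (d : ℝ) ≠ 0 := NeZero.ne _
  have hr : (r : ℝ) ≠ 0 := NeZero.ne _
  let g : (I × Fin d) ⊕ (U × Fin r) → ℝ := fun a =>
    (S.realization d r).output w x a * (S.realization d r).output w x' a *
      Sum.elim (fun _ => 1 / (Fintype.card (S.In v) : ℝ))
        (fun u => 1 / r / (actNorm (S.act u.1) ^ 2 * Fintype.card (S.In v))) a
  have h1 : ∀ a : (S.realization d r).In (v, k), (S.realization d r).output w x a.1 *
      (S.realization d r).output w x' a.1 *
      (S.realization d r).initVariance ⟨(a.1, (v, k)), a.2⟩ = g a.1 := by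
    rintro ⟨a | a, ha⟩
    · simp only [g, NeuralNetwork.initVariance, inWeight_realization, Sum.elim_inl]
      simp [realization, hd]
    · simp only [g, NeuralNetwork.initVariance, inWeight_realization, Sum.elim_inr]
      simp [realization]
  rw [Finset.sum_congr rfl fun a _ => h1 a, S.sum_realization_in v k g, empiricalInKernel,
    Finset.sum_div]
  refine Finset.sum_congr rfl ?_
  rintro ⟨i | u, hu⟩ -
  · simp only [Sum.elim_inl, g, empiricalNodeKernel, PiLp.inner_apply, Finset.sum_div]
    refine Finset.sum_congr rfl fun j _ => ?_
    simp [NeuralNetwork.output, ActivationDAG.propagate_inl, realization]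
    ring
  · simp only [Sum.elim_inr, g, empiricalNodeKernel, Finset.sum_div]
    refine Finset.sum_congr rfl fun j _ => ?_
    field_simp

theorem empiricalKernel_realization (w : (S.realization d r).Edge → ℝ)
    (x x' : InputSpace n d) :
    (S.realization d r).empiricalKernel w x x' = S.empiricalNodeKernel w x x' (.inr S.out) := by
  classical
  have hout : ∀ k : Fin r, (S.realization d r).IsOutput (S.out, k) := fun k a =>
    (S.isOutput_iff S.out).2 rfl a.1
  have hbij : Function.Bijective
      fun k : Fin r => (⟨(S.out, k), hout k⟩ : (S.realization d r).Outputs) := by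
    refine ⟨fun k l h => by simpa using h, ?_⟩
    rintro ⟨⟨v, k⟩, hv⟩
    have : v = S.out := (S.isOutput_iff v).1 fun u hu => hv (u, k) hu
    subst this
    exact ⟨k, rfl⟩
  have hcard : Fintype.card (S.realization d r).Outputs = r := by
    rw [← Fintype.card_of_bijective hbij, Fintype.card_fin]
  have hr : (0 : ℝ) ≤ r := Nat.cast_nonneg r
  rw [NeuralNetwork.empiricalKernel, PiLp.inner_apply,
    ← Fintype.sum_bijective _ hbij _ _ fun k => rfl]
  simp only [empiricalNodeKernel, Sum.elim_inr, NeuralNetwork.normalizedRep, Finset.sum_div]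
  refine Finset.sum_congr rfl fun k _ => ?_
  have hsq : √(r : ℝ) ^ 2 = r := Real.sq_sqrt hr
  simp only [RCLike.inner_apply, conj_trivial]
  rw [div_mul_div_comm, div_div, show Fintype.card (S.realization d r).Outputs = r by
    convert! hcard, mul_mul_mul_comm, ← pow_two, ← pow_two, hsq, mul_comm]
  rfl

end ComputationSkeleton

/-- A geometric mean of two numbers in [1 - η, 1 + η] stays there; η ≤ 1 makes the lower end
nonnegative. -/
theorem abs_sqrt_mul_sqrt_sub_one_le {a c η : ℝ} (ha0 : 0 ≤ a) (hη : η ≤ 1)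
    (ha : |a - 1| ≤ η) (hc : |c - 1| ≤ η) : |√a * √c - 1| ≤ η := by
  obtain ⟨ha1, ha2⟩ := abs_le.1 ha
  obtain ⟨hc1, hc2⟩ := abs_le.1 hc
  have hη0 : 0 ≤ η := (abs_nonneg _).trans ha
  rw [← Real.sqrt_mul ha0, abs_le]
  have h1 : √(a * c) ≤ 1 + η := Real.sqrt_le_iff.2 ⟨by linarith, by nlinarith⟩
  have h2 : 1 - η ≤ √(a * c) := Real.le_sqrt_of_sq_le (by nlinarith)
  constructor <;> linarith

/-! ### Error propagation through the skeleton -/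

namespace ComputationSkeleton

theorem not_reflTransGen_of_edge {n : ℕ} {I U : Type*} {S : ComputationSkeleton n I U}
    {u v : U} (h : S.edge (.inr u) v) :
    ¬ Relation.ReflTransGen (fun u v => S.edge (.inr u) v) v u := fun h' =>
  S.acyclic v (Relation.TransGen.tail' h' h)

variable {n d r : ℕ} {I U : Type*} [Fintype I] [Fintype U] {S : ComputationSkeleton n I U}

theorem depthAt_add_one_le {u : I ⊕ U} {v : U} (h : S.edge u v) :
    S.depthAt u + 1 ≤ S.depthAt (.inr v) := by
  classical
  rw [ActivationDAG.depthAt, ActivationDAG.propagate_inr]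
  exact Finset.le_sup (f := fun u : S.In v => S.propagate (fun _ => 0)
    (fun _ f => Finset.univ.sup fun u => f u + 1) u.1 + 1) (Finset.mem_univ ⟨u, h⟩)

theorem depthAt_le_depth (u : I ⊕ U) : S.depthAt u ≤ S.depth :=
  Finset.le_sup (f := S.depthAt) (Finset.mem_univ u)

theorem depth_pos (S : ComputationSkeleton n I U) : 0 < S.depth := by
  obtain ⟨u, hu⟩ := S.exists_edge S.out
  exact (Nat.succ_pos _).trans_le ((depthAt_add_one_le hu).trans (depthAt_le_depth _))

variable [NeZero d] [NeZero r]

instance : IsProbabilityMeasure (S.realization d r).randomInit := by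
  unfold NeuralNetwork.randomInit
  infer_instance

open scoped Classical in
/-- The edge weights `w`, with those of the edges into the neurons of the node `v` replaced by
the weights `w'`. -/
noncomputable abbrev replaceAt (v : U) (w' w : (S.realization d r).Edge → ℝ) :
    (S.realization d r).Edge → ℝ :=
  {e : (S.realization d r).Edge | e.1.2.1 = v}.piecewise w' w

open scoped Classical in
theorem output_replaceAt (v : U) (w' w : (S.realization d r).Edge → ℝ) (x : InputSpace n d)
    (a : (I × Fin d) ⊕ (U × Fin r)) (ha : S.edge (Sum.map Prod.fst Prod.fst a) v) :
    (S.realization d r).output (replaceAt v w' w) x a = (S.realization d r).output w x a := by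
  refine NeuralNetwork.output_congr _ x
    -- The neurons over descendants of `v`, including `v`; acyclicity keeps the in-neighbours of `v`
    -- outside.
    (T := {z | Relation.ReflTransGen (fun u v => S.edge (.inr u) v) v z.1}) ?_ ?_ a ?_
  · intro a b hab ha
    exact Relation.ReflTransGen.tail ha hab
  · intro e he
    refine Set.piecewise_eq_of_notMem _ _ _ fun hev => he ?_
    rw [Set.mem_ofPred_eq] at hev
    rw [Set.mem_ofPred_eq, hev]
  · rintro z hz rfl
    exact not_reflTransGen_of_edge ha hz

theorem empiricalNodeKernel_replaceAt (v : U) (w' w : (S.realization d r).Edge → ℝ)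
    (x x' : InputSpace n d) {u : I ⊕ U} (hu : S.edge u v) :
    S.empiricalNodeKernel (replaceAt v w' w) x x' u = S.empiricalNodeKernel w x x' u := by
  rcases u with i | u
  · rfl
  · simp only [empiricalNodeKernel, Sum.elim_inr]
    congr 1
    refine Finset.sum_congr rfl fun k _ => ?_
    rw [output_replaceAt v w' w x (.inr (u, k)) hu, output_replaceAt v w' w x' (.inr (u, k)) hu]

/-- The coefficients of the preactivation of the neuron `(v, k)` as a linear form in the
weights of the edges. -/
noncomputable def inCoeff (w : (S.realization d r).Edge → ℝ) (x : InputSpace n d) (v : U)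
    (k : Fin r) : (S.realization d r).Edge → ℝ :=
  {e | e.1.2 = (v, k)}.indicator fun e => (S.realization d r).output w x e.1.1

theorem inCoeff_of_ne {w : (S.realization d r).Edge → ℝ} {x : InputSpace n d} {v : U}
    {k : Fin r} {e : (S.realization d r).Edge} (h : e.1.2 ≠ (v, k)) : inCoeff w x v k e = 0 :=
  Set.indicator_of_notMem (s := {e : (S.realization d r).Edge | e.1.2 = (v, k)}) h _

open scoped Classical in
theorem output_replaceAt_self (v : U) (k : Fin r) (w' w : (S.realization d r).Edge → ℝ)
    (x : InputSpace n d) :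
    (S.realization d r).output (replaceAt v w' w) x (.inr (v, k)) =
      S.act v (∑ e, inCoeff w x v k e * w' e) := by
  rw [NeuralNetwork.output_inr]
  change S.act v _ = _
  congr 1
  simp_rw [inCoeff, ← Set.indicator_mul_left]
  rw [← NeuralNetwork.sum_in_eq_sum_edge _ (v, k)
    fun e => (S.realization d r).output w x e.1.1 * w' e]
  refine Finset.sum_congr rfl fun a _ => ?_
  rw [output_replaceAt v w' w x _ a.2, replaceAt, Set.piecewise_eq_of_mem _ _ _ (by simp), mul_comm]

open scoped Classical in
theorem sum_inCoeff_mul_inCoeff (v : U) (k : Fin r) (w : (S.realization d r).Edge → ℝ)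
    (x x' : InputSpace n d) :
    ∑ e, inCoeff w x v k e * inCoeff w x' v k e *
      (((S.realization d r).initVariance e).toNNReal : ℝ) = S.empiricalInKernel w x x' v := by
  have h : ∀ e, inCoeff w x v k e * inCoeff w x' v k e *
      (((S.realization d r).initVariance e).toNNReal : ℝ) =
      {e : (S.realization d r).Edge | e.1.2 = (v, k)}.indicator
        (fun e => (S.realization d r).output w x e.1.1 * (S.realization d r).output w x' e.1.1 *
          (S.realization d r).initVariance e) e := fun e => by
    rw [Real.coe_toNNReal _ (NeuralNetwork.initVariance_nonneg _ e), inCoeff, inCoeff]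
    by_cases he : e ∈ {e : (S.realization d r).Edge | e.1.2 = (v, k)}
    · simp only [Set.indicator_of_mem he]
    · simp only [Set.indicator_of_notMem he, zero_mul]
  simp_rw [h]
  rw [← sum_initVariance_mul_output S w x x' v k, ← NeuralNetwork.sum_in_eq_sum_edge _ (v, k)
    fun e => (S.realization d r).output w x e.1.1 * (S.realization d r).output w x' e.1.1 *
        (S.realization d r).initVariance e]

theorem abs_empiricalInKernel_sub_le {w : (S.realization d r).Edge → ℝ} {x x' : InputSpace n d}
    {v : U} {η : ℝ} (hη : 0 ≤ η) (h : ∀ u, S.edge u v →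
      |S.empiricalNodeKernel w x x' u - S.nodeKernel x x' u| ≤ η) :
    |S.empiricalInKernel w x x' v - S.inKernel x x' v| ≤ η := by
  classical
  rw [empiricalInKernel, inKernel, ← sub_div, ← Finset.sum_sub_distrib]
  exact abs_sum_div_card_le hη fun u => h u.1 u.2

/-- If the empirical kernels of the nodes incoming to `v` are close to the kernels, then so is
the empirical kernel of `v`, with high probability over the edges into the neurons of `v`. -/
theorem measureReal_empiricalNodeKernel_replaceAt_le (hS : ∀ v, IsReLU (S.act v))
    (w : (S.realization d r).Edge → ℝ) {x x' : InputSpace n d} {v : U} {η : ℝ} (hη0 : 0 ≤ η)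
    (hη : η ≤ 1)
    (h₁ : ∀ u, S.edge u v → |S.empiricalNodeKernel w x x u - S.nodeKernel x x u| ≤ η)
    (h₂ : ∀ u, S.edge u v → |S.empiricalNodeKernel w x x' u - S.nodeKernel x x' u| ≤ η)
    (h₃ : ∀ u, S.edge u v → |S.empiricalNodeKernel w x' x' u - S.nodeKernel x' x' u| ≤ η)
    {t : ℝ} (ht0 : 0 ≤ t) (ht : t ≤ 1) :
    (S.realization d r).randomInit.real {w' | η + t <
      |S.empiricalNodeKernel (replaceAt v w' w) x x' (.inr v) - S.nodeKernel x x' (.inr v)|} ≤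
      2 * Real.exp (-(r * t ^ 2 / 32768)) := by
  classical
  have h₁' := abs_empiricalInKernel_sub_le hη0 h₁
  have h₂' := abs_empiricalInKernel_sub_le hη0 h₂
  have h₃' := abs_empiricalInKernel_sub_le hη0 h₃
  rw [inKernel_self hS] at h₁' h₃'
  have hdisj : ∀ k l : Fin r, k ≠ l → ∀ e,
      (inCoeff w x v k e = 0 ∧ inCoeff w x' v k e = 0) ∨
        (inCoeff w x v l e = 0 ∧ inCoeff w x' v l e = 0) := by
    intro k l hkl e
    · by_cases hk : e.1.2 = (v, k)
      · have : e.1.2 ≠ (v, l) := by rw [hk]; simpa using hkl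
        right
        exact ⟨inCoeff_of_ne this, inCoeff_of_ne this⟩
      · left
        exact ⟨inCoeff_of_ne hk, inCoeff_of_ne hk⟩
  obtain ⟨ha0, hc0, θ, hθ, hbθ, hconc⟩ := exists_measureReal_mean_relu_linearForm_sub_ge_le
    (fun e => ((S.realization d r).initVariance e).toNNReal) (NeZero.ne r)
    (fun k => inCoeff w x v k) (fun k => inCoeff w x' v k) hdisj
    (fun k => sum_inCoeff_mul_inCoeff v k w x x) (fun k => sum_inCoeff_mul_inCoeff v k w x x')
    (fun k => sum_inCoeff_mul_inCoeff v k w x' x') (by linarith [(abs_le.1 h₁').2])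
    (by linarith [(abs_le.1 h₃').2])
  refine le_trans (measureReal_mono ?_) (hconc t ht0 ht)
  intro w' hw'
  have hK : S.empiricalNodeKernel (replaceAt v w' w) x x' (.inr v) =
      (∑ k, 2 * (max (∑ e, inCoeff w x v k e * w' e) 0 *
        max (∑ e, inCoeff w x' v k e * w' e) 0)) / r := by
    simp only [empiricalNodeKernel, Sum.elim_inr]
    congr 1
    refine Finset.sum_congr rfl fun k _ => ?_
    rw [output_replaceAt_self, output_replaceAt_self, (hS v).mul_div_actNorm_sq]
  obtain ⟨hk1, hk2⟩ := abs_le.1 (abs_inKernel_le_one hS x x' v)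
  -- Bias of the conditional mean: nonexpansiveness with s = √a √c from the empirical covariance and
  -- s' = 1 from the exact one.
  have hlip : |√(S.empiricalInKernel w x x v) * √(S.empiricalInKernel w x' x' v) *
      arcCosKernel θ - 1 * arcCosKernel (Real.arccos (S.inKernel x x' v))| ≤ η := by
    refine abs_mul_arcCosKernel_sub_le (by positivity) zero_le_one hθ
      ⟨Real.arccos_nonneg _, Real.arccos_le_pi _⟩ (abs_sqrt_mul_sqrt_sub_one_le ha0 hη h₁' h₃') ?_
    rwa [← hbθ, Real.cos_arccos hk1 hk2, one_mul]
  rw [one_mul, ← nodeKernel_inr_eq_arcCosKernel hS] at hlip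
  rw [Set.mem_ofPred_eq] at hw' ⊢
  rw [hK] at hw'
  have := abs_sub_le ((∑ k, 2 * (max (∑ e, inCoeff w x v k e * w' e) 0 *
        max (∑ e, inCoeff w x' v k e * w' e) 0)) / r)
    (√(S.empiricalInKernel w x x v) * √(S.empiricalInKernel w x' x' v) * arcCosKernel θ)
    (S.nodeKernel x x' (.inr v))
  linarith

/-- At the node `u`, the empirical kernels of all pairs of the inputs `X` are within
`depthAt u * t` of the kernels. -/
def IsAccurate (X : Bool → InputSpace n d) (t : ℝ) (w : (S.realization d r).Edge → ℝ)
    (u : I ⊕ U) : Prop :=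
  ∀ i j, |S.empiricalNodeKernel w (X i) (X j) u - S.nodeKernel (X i) (X j) u| ≤ S.depthAt u * t

theorem isAccurate_replaceAt_iff {X : Bool → InputSpace n d} {t : ℝ} {v : U}
    {w' w : (S.realization d r).Edge → ℝ} {u : I ⊕ U} (hu : S.edge u v) :
    IsAccurate X t (replaceAt v w' w) u ↔ IsAccurate X t w u := by
  simp only [IsAccurate, empiricalNodeKernel_replaceAt v w' w _ _ hu]

theorem measurableSet_isAccurate (hS : ∀ v, IsReLU (S.act v)) (X : Bool → InputSpace n d) (t : ℝ)
    (u : I ⊕ U) :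
    MeasurableSet {w : (S.realization d r).Edge → ℝ | IsAccurate X t w u} := by
  simp only [IsAccurate]
  refine IsClosed.measurableSet ?_
  have h := continuous_empiricalNodeKernel (d := d) (r := r) S hS
  simp only [Set.ofPred_forall]
  exact isClosed_iInter fun i => isClosed_iInter fun j =>
    isClosed_le ((h (X i) (X j) u).sub continuous_const).abs continuous_const

/-- Accuracy of the in-neighbours is unaffected by the weights into `v`, so it can be decided before
those weights are resampled. -/
theorem measureReal_not_isAccurate_le (hS : ∀ v, IsReLU (S.act v)) (X : Bool → InputSpace n d)
    {t : ℝ} (ht0 : 0 ≤ t) (ht : S.depth * t ≤ 1) (v : U) :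
    (S.realization d r).randomInit.real {w | (∀ u, S.edge u v → IsAccurate X t w u) ∧
      ¬ IsAccurate X t w (.inr v)} ≤ 8 * Real.exp (-(r * t ^ 2 / 32768)) := by
  classical
  have hdv : (1 : ℝ) ≤ S.depthAt (.inr v) := by
    obtain ⟨u, hu⟩ := S.exists_edge v
    exact_mod_cast (Nat.le_add_left 1 _).trans (depthAt_add_one_le hu)
  have hdd : (S.depthAt (.inr v) : ℝ) * t ≤ S.depth * t :=
    mul_le_mul_of_nonneg_right (by exact_mod_cast depthAt_le_depth _) ht0
  have ht1 : t ≤ 1 := by nlinarith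
  refine measureReal_pi_le_of_forall_piecewise _
    {e : (S.realization d r).Edge | e.1.2.1 = v} ?_ (by positivity) fun w => ?_
  · have : {w : (S.realization d r).Edge → ℝ | (∀ u, S.edge u v → IsAccurate X t w u) ∧
        ¬ IsAccurate X t w (.inr v)} = (⋂ u, ⋂ (_ : S.edge u v), {w | IsAccurate X t w u}) ∩
        {w | IsAccurate X t w (.inr v)}ᶜ := by
      ext w
      simp
    rw [this]
    exact (MeasurableSet.iInter fun u => MeasurableSet.iInter fun _ =>
      measurableSet_isAccurate hS X t u).inter (measurableSet_isAccurate hS X t _).compl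
  change (S.realization d r).randomInit.real
    {w' | (∀ u, S.edge u v → IsAccurate X t (replaceAt v w' w) u) ∧
      ¬ IsAccurate X t (replaceAt v w' w) (.inr v)} ≤ _
  by_cases hw : ∀ u, S.edge u v → IsAccurate X t w u
  -- In-neighbours have depth at least one less, which leaves exactly one `t` for the sampling error
  -- at `v`.
  · set η := (S.depthAt (.inr v) : ℝ) * t - t with hη
    have hη0 : 0 ≤ η := by nlinarith
    have hη1 : η ≤ 1 := by linarith
    have hacc : ∀ i j u, S.edge u v →
        |S.empiricalNodeKernel w (X i) (X j) u - S.nodeKernel (X i) (X j) u| ≤ η := by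
      intro i j u hu
      refine (hw u hu i j).trans ?_
      have : (S.depthAt u : ℝ) + 1 ≤ S.depthAt (.inr v) := by
        exact_mod_cast depthAt_add_one_le hu
      nlinarith
    let B : Bool × Bool → Set ((S.realization d r).Edge → ℝ) := fun p =>
      {w' | η + t < |S.empiricalNodeKernel (replaceAt v w' w) (X p.1) (X p.2) (.inr v) -
        S.nodeKernel (X p.1) (X p.2) (.inr v)|}
    calc _ ≤ (S.realization d r).randomInit.real (⋃ p, B p) := by
          refine measureReal_mono fun w' hw' => ?_
          have := hw'.2
          simp only [IsAccurate, not_forall, not_le] at this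
          obtain ⟨i, j, hij⟩ := this
          refine Set.mem_iUnion.2 ⟨(i, j), ?_⟩
          rw [Set.mem_ofPred_eq, hη, sub_add_cancel]
          exact hij
      _ ≤ ∑ p, (S.realization d r).randomInit.real (B p) := measureReal_iUnion_fintype_le _
      _ ≤ ∑ _p : Bool × Bool, 2 * Real.exp (-(r * t ^ 2 / 32768)) :=
          Finset.sum_le_sum fun p _ => measureReal_empiricalNodeKernel_replaceAt_le hS w hη0 hη1
            (hacc _ _) (hacc _ _) (hacc _ _) ht0 ht1
      -- Four ordered pairs of inputs, two tails each. The diagonal pairs are included because the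
      -- next nodes need accurate variances.
      _ = 8 * Real.exp (-(r * t ^ 2 / 32768)) := by simp; ring
  · have : {w' | (∀ u, S.edge u v → IsAccurate X t (replaceAt v w' w) u) ∧
        ¬ IsAccurate X t (replaceAt v w' w) (.inr v)} = ∅ := by
      refine Set.eq_empty_of_forall_notMem fun w' hw' => hw fun u hu => ?_
      exact (isAccurate_replaceAt_iff hu).1 (hw'.1 u hu)
    rw [this, measureReal_empty]
    positivity

theorem isAccurate_inl (X : Bool → InputSpace n d) {t : ℝ} (ht : 0 ≤ t)
    (w : (S.realization d r).Edge → ℝ) (i : I) : IsAccurate X t w (.inl i) := fun j k => by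
  rw [nodeKernel_inl, empiricalNodeKernel, Sum.elim_inl, sub_self, abs_zero]
  positivity

/-- An inaccurate node forces the existence of one that is inaccurate while all its in-neighbours
are accurate, by well-founded induction; a union bound over such nodes remains. -/
theorem measureReal_not_isAccurate_inr_le (hS : ∀ v, IsReLU (S.act v))
    (X : Bool → InputSpace n d) {t : ℝ} (ht0 : 0 ≤ t) (ht : S.depth * t ≤ 1) (v : U) :
    (S.realization d r).randomInit.real {w | ¬ IsAccurate X t w (.inr v)} ≤
      8 * S.size * Real.exp (-(r * t ^ 2 / 32768)) := by
  let B : U → Set ((S.realization d r).Edge → ℝ) := fun v =>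
    {w | (∀ u, S.edge u v → IsAccurate X t w u) ∧ ¬ IsAccurate X t w (.inr v)}
  calc _ ≤ (S.realization d r).randomInit.real (⋃ v, B v) := by
        refine measureReal_mono fun w hw => ?_
        by_contra hB
        refine hw ?_
        clear hw
        induction v using S.wellFounded.induction with
        | _ v ih =>
          by_contra hv
          refine hB (Set.mem_iUnion.2 ⟨v, ?_, hv⟩)
          rintro (u | u) hu
          · exact isAccurate_inl X ht0 w u
          · exact ih u hu
    _ ≤ ∑ v, (S.realization d r).randomInit.real (B v) := measureReal_iUnion_fintype_le _
    _ ≤ ∑ _v : U, 8 * Real.exp (-(r * t ^ 2 / 32768)) :=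
        Finset.sum_le_sum fun v _ => measureReal_not_isAccurate_le hS X ht0 ht v
    _ = _ := by simp [size]; ring

end ComputationSkeleton

theorem theorem2 :
    ∃ c₁ : ℝ, 0 < c₁ ∧ ∃ c₂ : ℝ, 0 < c₂ ∧
      ∀ (I U : Type*) [Fintype I] [Fintype U] (n d : ℕ) [NeZero d]
        (S : ComputationSkeleton n I U), (∀ v, IsReLU (S.act v)) →
      ∀ (r : ℕ) [NeZero r] (ε δ : ℝ), 0 < δ → δ < 1 →
        0 < ε → ε ≤ min c₂ (1 / (S.depth : ℝ)) →
        c₁ * (S.depth : ℝ) ^ 2 * Real.log (8 * (S.size : ℝ) / δ) / ε ^ 2 ≤ (r : ℝ) →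
      ∀ x x' : InputSpace n d,
        1 - δ ≤ (S.realization d r).randomInit.real
          {w | |(S.realization d r).empiricalKernel w x x' - S.kernel x x'| ≤ ε} := by
  -- 32768 is the constant of the Chernoff exponent; the bound 1 on ε gives `depth * t ≤ 1`, which
  -- keeps every error in the range of the one-node estimate.
  refine ⟨32768, by norm_num, 1, one_pos, ?_⟩
  intro I U _ _ n d _ S hS r _ ε δ hδ _ hε hε' hr x x'
  have hdepth : (0 : ℝ) < S.depth := by exact_mod_cast S.depth_pos
  have hsize : (0 : ℝ) < S.size := by
    have : Nonempty U := ⟨S.out⟩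
    exact_mod_cast Fintype.card_pos (α := U)
  set t := ε / S.depth with ht
  have hdt : S.depth * t = ε := by rw [ht]; field_simp
  have ht0 : 0 ≤ t := by positivity
  let X : Bool → InputSpace n d := fun b => if b then x else x'
  have hbad := ComputationSkeleton.measureReal_not_isAccurate_inr_le (r := r) hS X ht0
    (by rw [hdt]; exact hε'.trans (min_le_left _ _)) S.out
  have hexp : 8 * S.size * Real.exp (-(r * t ^ 2 / 32768)) ≤ δ := by
    have hlog : Real.log (8 * S.size / δ) ≤ r * t ^ 2 / 32768 := by
      rw [div_le_iff₀ (by positivity)] at hr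
      rw [ht, div_pow, ← mul_div_assoc, div_div, le_div_iff₀ (by positivity)]
      linarith
    calc 8 * S.size * Real.exp (-(r * t ^ 2 / 32768))
        ≤ 8 * S.size * Real.exp (-Real.log (8 * S.size / δ)) := by gcongr
      _ = δ := by
        rw [Real.exp_neg, Real.exp_log (by positivity)]
        field_simp
  have hgood' := probReal_compl_eq_one_sub (μ := (S.realization d r).randomInit)
    (ComputationSkeleton.measurableSet_isAccurate (r := r) hS X t (.inr S.out))
  rw [Set.compl_ofPred] at hgood'
  refine le_trans (by linarith) (measureReal_mono
    (s₁ := {w | ComputationSkeleton.IsAccurate X t w (.inr S.out)}) fun w hw => ?_)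
  have := hw true false
  rw [Set.mem_ofPred_eq, S.empiricalKernel_realization]
  refine le_trans this ?_
  rw [← hdt]
  exact mul_le_mul_of_nonneg_right
    (by exact_mod_cast ComputationSkeleton.depthAt_le_depth _) ht0
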